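/- **Theorem (random matrix invariance principle).** For every real constant $C$ there is a constant $K=K(C)>0$ such that the following holds for all integers $m,n\ge 1$. Let $X=(x_1,\dots,x_n)^T$ and $Z=(z_1,\dots,z_n)^T$ be random vectors in $\mathbb R^n$ and let $S=(S_{ij})$ be a random real $m\times n$ matrix, such that $X$, $Z$ and $S$ are mutually independent and each of the three has i.i.d. entries. Assume that $$\mathbb E x_i=\mathbb E z_i=\mathbb E S_{ij}=0,\qquad \mathbb E x_i^2=\mathbb E z_i^2=\mathbb E S_{ij}^2=1,$$ $$\mathbb E|x_i|^3<C,\qquad \mathbb E|z_i|^3<C,\qquad \mathbb E z_i^4<C,\qquad \mathbb E S_{ij}^8<C .$$ Then, with $G$ a standard normal random variable, $$\sup_{t\in\mathbb R}\left|P\left(\frac{1}{\sqrt{m^2n+mn^2}}\,X^TS^TSZ<t\right)-P(G<t)\right|\le K\left(\frac1{\sqrt n}+\frac1{\sqrt m}\right)$$ and $$\sup_{t\in\mathbb R}\left|P\left(\frac{1}{\sqrt{m^2n+mn^2}}\,X^TS^TSZ<t\right)-P\left(\frac{1}{\sqrt n}\,X^TZ<t\right)\right|\le K\left(\frac1{\sqrt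 n}+\frac1{\sqrt m}\right).$$ -/

import Mathlib

open MeasureTheory ProbabilityTheory
open scoped Matrix

/-!
Conditionally on `S` and `Z`, the statistic `XᵀSᵀSZ` is a sum `∑ xᵢ Vᵢ` of independent variables with
deterministic weights `V = SᵀSZ`, and `XᵀZ` is such a sum with weights `V = Z`. So the argument has a
Berry–Esseen part for weighted sums and a moment part for the weights.

*Berry–Esseen.* For standardised `xᵢ` with bounded third moments and arbitrary weights,
`|P(∑ xᵢ vᵢ < t) - P(G < t)|` is at most a constant times `∑ |vᵢ|³ + |∑ vᵢ² - 1|`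
(`exists_berryEsseen_weighted`). The second term allows weights of norm different from one, so that no
separate estimate for rescaled Gaussians is needed. The proof is Fourier analytic: Esseen's smoothing
inequality (`exists_esseen_smoothing`), here with the Fejér kernel, together with a comparison of
characteristic functions (`norm_prod_charFun_sub_le`). Fubini's theorem turns this into a bound for
random weights by `E ∑ |Vᵢ|³ + E |∑ Vᵢ² - 1|` (`exists_berryEsseen_random_weights`).

*Moments of the weights.* Fix `z` and let `s₁, …, sₘ` be the rows of `S`. Then
`SᵀSz = ∑ₖ sₖ ⟨sₖ, z⟩ = m z + ∑ₖ ηₖ`, where the `ηₖ = sₖ ⟨sₖ, z⟩ - z` are independent, centred and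
identically distributed. All that is needed about one `η` are four estimates, obtained by isolating
single entries of a row: `E ηᵢ⁴ ≲ |z|⁴`, `E |η|² = (n + κ - 2) |z|²` with `κ = E s⁴`,
`E |η|⁴ ≲ n² |z|⁴`, and `E ⟨u, η⟩² ≲ |u|² |z|²`. Fourth moments of the coordinates of `SᵀSz` follow from
a Khintchine-type inequality (`integral_pow_four_sum_le`). For the squared norm, `|∑ₖ ηₖ|² - m E |η|²` is
a martingale in `m` whose increments have controlled second moments
(`integral_norm_sq_sum_sub_sq_le`). This gives, after averaging over `z`,
`E Vᵢ⁴ ≲ m² (m + n)²` and `E (|V|² - σ²)² ≲ σ⁴ (1 / n + 1 / m)` with `σ² = m² n + m n²`. Hence the error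
terms for the normalised weights `V / σ` are of order `1 / √n + 1 / √m`
(`integral_gramMulVec_weight_error_le`).
-/

/-! ### The Fejér kernel -/

/-- The (unnormalised) Fejér kernel with frequency cut-off `T`. -/
noncomputable def fejerKernel (T y : ℝ) : ℝ := ∫ t in (0 : ℝ)..T, (1 - t / T) * Real.cos (t * y)

lemma continuous_fejerKernel (T : ℝ) : Continuous (fejerKernel T) := by
  unfold fejerKernel
  apply intervalIntegral.continuous_parametric_intervalIntegral_of_continuous'
  fun_prop

lemma fejerKernel_of_ne_zero {T y : ℝ} (hT : 0 < T) (hy : y ≠ 0) :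
    fejerKernel T y = (1 - Real.cos (T * y)) / (T * y ^ 2) := by
  have hd : ∀ t ∈ Set.uIcc 0 T, HasDerivAt
      (fun t => (1 - t / T) * (Real.sin (t * y) / y) - Real.cos (t * y) / (T * y ^ 2))
      ((1 - t / T) * Real.cos (t * y)) t := by
    intro t _
    have h1 : HasDerivAt (fun t : ℝ => t * y) y t := by simpa using (hasDerivAt_id t).mul_const y
    have h2 : HasDerivAt (fun t : ℝ => 1 - t / T) (-(1 / T)) t := by
      simpa using ((hasDerivAt_id t).div_const T).const_sub 1
    have h3 := (h2.mul (h1.sin.div_const y)).sub (h1.cos.div_const (T * y ^ 2))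
    convert! h3 using 1
    field_simp
    ring
  have hint : IntervalIntegrable (fun t => (1 - t / T) * Real.cos (t * y)) volume 0 T :=
    Continuous.intervalIntegrable (by fun_prop) _ _
  rw [fejerKernel, intervalIntegral.integral_eq_sub_of_hasDerivAt hd hint]
  field_simp
  simp
  ring

lemma fejerKernel_zero {T : ℝ} (hT : 0 < T) : fejerKernel T 0 = T / 2 := by
  have : fejerKernel T 0 = ∫ t in (0 : ℝ)..T, (1 - t / T) := by simp [fejerKernel]
  rw [this, intervalIntegral.integral_sub (by simp)
    (Continuous.intervalIntegrable (by fun_prop) _ _)]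
  simp only [intervalIntegral.integral_div, integral_id, intervalIntegral.integral_const]
  simp
  field_simp
  ring

lemma fejerKernel_eq_mul {T : ℝ} (hT : 0 < T) (y : ℝ) :
    fejerKernel T y = T * fejerKernel 1 (T * y) := by
  rcases eq_or_ne y 0 with rfl | hy
  · rw [mul_zero, fejerKernel_zero hT, fejerKernel_zero one_pos]; ring
  · rw [fejerKernel_of_ne_zero hT hy, fejerKernel_of_ne_zero one_pos (mul_ne_zero hT.ne' hy)]
    field_simp

lemma fejerKernel_nonneg {T : ℝ} (hT : 0 < T) (y : ℝ) : 0 ≤ fejerKernel T y := by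
  rcases eq_or_ne y 0 with rfl | hy
  · rw [fejerKernel_zero hT]; positivity
  · rw [fejerKernel_of_ne_zero hT hy]
    have := Real.cos_le_one (T * y)
    exact div_nonneg (by linarith) (by positivity)

lemma fejerKernel_one_le (y : ℝ) : fejerKernel 1 y ≤ 4 * (1 + y ^ 2)⁻¹ := by
  rw [← div_eq_mul_inv]
  rcases eq_or_ne y 0 with rfl | hy
  · rw [fejerKernel_zero one_pos]; norm_num
  · rw [fejerKernel_of_ne_zero one_pos hy, one_mul, one_mul,
      div_le_div_iff₀ (by positivity) (by positivity)]
    have h1 := Real.neg_one_le_cos y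
    have h2 := Real.one_sub_sq_div_two_le_cos (x := y)
    nlinarith [sq_nonneg y]

lemma integrable_fejerKernel {T : ℝ} (hT : 0 < T) : Integrable (fejerKernel T) := by
  have h1 : Integrable (fejerKernel 1) := by
    refine (integrable_inv_one_add_sq.const_mul 4).mono'
      (continuous_fejerKernel 1).aestronglyMeasurable (.of_forall fun y => ?_)
    rw [Real.norm_of_nonneg (fejerKernel_nonneg one_pos y)]
    exact fejerKernel_one_le y
  have h2 := (h1.comp_mul_left' hT.ne').const_mul T
  exact h2.congr (.of_forall fun y => (fejerKernel_eq_mul hT y).symm)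

lemma integral_fejerKernel {T : ℝ} (hT : 0 < T) : ∫ y, fejerKernel T y = ∫ y, fejerKernel 1 y := by
  simp_rw [fejerKernel_eq_mul hT]
  rw [integral_const_mul, Measure.integral_comp_mul_left (fejerKernel 1) T, abs_of_pos (inv_pos.2 hT)]
  simp only [smul_eq_mul]
  field_simp

lemma integral_fejerKernel_pos : 0 < ∫ y, fejerKernel 1 y := by
  rw [integral_pos_iff_support_of_nonneg (fejerKernel_nonneg one_pos)
    (integrable_fejerKernel one_pos)]
  refine (IsOpen.measure_pos _ ((continuous_fejerKernel 1).isOpen_support) ⟨0, ?_⟩)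
  simp [fejerKernel_zero one_pos]

/-- At scale `1 / T` the Fejér kernel has three quarters of its mass in a fixed window. -/
lemma exists_fejerKernel_window : ∃ a : ℝ, 0 < a ∧ ∀ T : ℝ, 0 < T →
    3 / 4 * ∫ y, fejerKernel 1 y ≤ ∫ y in (-(a / T))..(a / T), fejerKernel T y := by
  have h := intervalIntegral_tendsto_integral (integrable_fejerKernel one_pos)
    Filter.tendsto_neg_atTop_atBot Filter.tendsto_id
  have hc := integral_fejerKernel_pos
  have h2 := h.eventually (lt_mem_nhds (show 3 / 4 * ∫ y, fejerKernel 1 y < ∫ y, fejerKernel 1 y by linarith))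
  obtain ⟨a, ha, hapos⟩ := (h2.and (Filter.eventually_gt_atTop 0)).exists
  refine ⟨a, hapos, fun T hT => ?_⟩
  simp_rw [fejerKernel_eq_mul hT]
  rw [intervalIntegral.integral_const_mul, intervalIntegral.mul_integral_comp_mul_left]
  have : T * (a / T) = a := by field_simp
  rw [mul_neg, this]
  exact ha.le

/-! ### Smoothing and Kolmogorov distance -/

lemma integral_fejerKernel_mul_measureReal_Ico (μ : Measure ℝ) [IsProbabilityMeasure μ]
    {T : ℝ} (hT : 0 < T) {a b : ℝ} (hab : a ≤ b) :
    ∫ y, fejerKernel T y * μ.real (Set.Ico (a - y) (b - y)) =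
      ∫ w, (∫ y in a..b, fejerKernel T (y - w)) ∂μ := by
  have hmeas : MeasurableSet {p : ℝ × ℝ | p.1 + p.2 ∈ Set.Ico a b} :=
    measurableSet_Ico.preimage (by fun_prop)
  have hint : Integrable (Function.uncurry fun y w : ℝ =>
      ({p : ℝ × ℝ | p.1 + p.2 ∈ Set.Ico a b}.indicator (fun p => fejerKernel T p.1) (y, w)))
      (volume.prod μ) := by
    have h1 : Integrable (fun p : ℝ × ℝ => fejerKernel T p.1) (volume.prod μ) :=
      (integrable_fejerKernel hT).comp_fst μ
    exact h1.indicator hmeas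
  have h := integral_integral_swap hint
  have e1 : ∀ y : ℝ, ∫ w, ({p : ℝ × ℝ | p.1 + p.2 ∈ Set.Ico a b}.indicator
      (fun p => fejerKernel T p.1) (y, w)) ∂μ
      = fejerKernel T y * μ.real (Set.Ico (a - y) (b - y)) := by
    intro y
    have : (fun w : ℝ => ({p : ℝ × ℝ | p.1 + p.2 ∈ Set.Ico a b}.indicator
      (fun p => fejerKernel T p.1) (y, w))) =
        (Set.Ico (a - y) (b - y)).indicator (fun _ => fejerKernel T y) := by
      ext w
      simp only [Set.indicator, Set.mem_ofPred_eq, Set.mem_Ico, sub_le_iff_le_add, lt_sub_iff_add_lt,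
        add_comm w y]
    rw [this, integral_indicator measurableSet_Ico]
    simp [mul_comm]
  have e2 : ∀ w : ℝ, ∫ y, ({p : ℝ × ℝ | p.1 + p.2 ∈ Set.Ico a b}.indicator
      (fun p => fejerKernel T p.1) (y, w)) = ∫ y in a..b, fejerKernel T (y - w) := by
    intro w
    have : (fun y : ℝ => ({p : ℝ × ℝ | p.1 + p.2 ∈ Set.Ico a b}.indicator
      (fun p => fejerKernel T p.1) (y, w))) =
        (Set.Ico (a - w) (b - w)).indicator (fejerKernel T) := by
      ext y
      simp only [Set.indicator, Set.mem_ofPred_eq, Set.mem_Ico, sub_le_iff_le_add, lt_sub_iff_add_lt]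
    rw [this, integral_indicator measurableSet_Ico, intervalIntegral.integral_comp_sub_right,
      intervalIntegral.integral_of_le (by linarith), integral_Ico_eq_integral_Ioc]
  simp_rw [e1, e2] at h
  exact h

lemma integral_cos_eq_re_charFun (μ : Measure ℝ) [IsProbabilityMeasure μ] (t y : ℝ) :
    ∫ w, Real.cos (t * (y - w)) ∂μ = (Complex.exp (-(t * Complex.I) * y) * charFun μ t).re := by
  have e : ∀ w : ℝ, Complex.exp (-(t * Complex.I) * y) * Complex.exp (t * w * Complex.I)
      = Complex.exp (((t * (w - y) : ℝ) : ℂ) * Complex.I) := by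
    intro w
    rw [← Complex.exp_add]
    congr 1
    push_cast
    ring
  rw [charFun_apply_real, ← integral_const_mul]
  simp_rw [e]
  have hint : Integrable (fun w : ℝ => Complex.exp (((t * (w - y) : ℝ) : ℂ) * Complex.I)) μ := by
    refine (integrable_const (1 : ℝ)).mono' (by fun_prop) (.of_forall fun w => ?_)
    rw [Complex.norm_exp_ofReal_mul_I]
  have h2 := integral_re (𝕜 := ℂ) hint
  simp only [RCLike.re_eq_complex_re] at h2
  rw [← h2]
  congr 1
  ext w
  rw [Complex.exp_ofReal_mul_I_re, ← Real.cos_neg]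
  congr 1
  ring

lemma integral_intervalIntegral_fejerKernel (μ : Measure ℝ) [IsProbabilityMeasure μ]
    {T : ℝ} (hT : 0 < T) {a b : ℝ} (hab : a ≤ b) :
    ∫ w, (∫ y in a..b, fejerKernel T (y - w)) ∂μ =
      ∫ t in (0 : ℝ)..T, (1 - t / T) *
        ∫ y in a..b, (Complex.exp (-(t * Complex.I) * y) * charFun μ t).re := by
  simp_rw [← integral_cos_eq_re_charFun, ← intervalIntegral.integral_const_mul, ← integral_const_mul]
  have hb : ∀ t ∈ Set.Ioc 0 T, ∀ x : ℝ, ‖(1 - t / T) * Real.cos x‖ ≤ 1 := by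
    intro t ht x
    rw [norm_mul]
    have h1 : ‖1 - t / T‖ ≤ 1 := by
      have := div_nonneg ht.1.le hT.le
      have := (div_le_one hT).2 ht.2
      rw [Real.norm_eq_abs, abs_le]; constructor <;> linarith
    exact mul_le_one₀ h1 (norm_nonneg _) (Real.abs_cos_le_one x)
  have hT' : ∀ᵐ t ∂(volume.restrict (Set.Ioc 0 T)), t ∈ Set.Ioc 0 T :=
    ae_restrict_mem measurableSet_Ioc
  -- the integrand is bounded by one on the finite measure `μ ⊗ [a, b] ⊗ [0, T]`
  have key : ∀ u : ℝ, Integrable (Function.uncurry fun y t => (1 - t / T) * Real.cos (t * (y - u)))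
      ((volume.restrict (Set.Ioc a b)).prod (volume.restrict (Set.Ioc 0 T))) := by
    intro u
    refine (integrable_const (1 : ℝ)).mono' (Continuous.aestronglyMeasurable (by fun_prop)) ?_
    have := (Measure.quasiMeasurePreserving_snd (μ := volume.restrict (Set.Ioc a b))
      (ν := volume.restrict (Set.Ioc 0 T))).ae hT'
    filter_upwards [this] with p hp
    exact hb _ hp _
  have s1 : ∀ w : ℝ, ∫ y in a..b, fejerKernel T (y - w) =
      ∫ t in Set.Ioc 0 T, ∫ y in a..b, (1 - t / T) * Real.cos (t * (y - w)) := by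
    intro w
    simp_rw [fejerKernel, intervalIntegral.integral_of_le hab, intervalIntegral.integral_of_le hT.le]
    exact integral_integral_swap (key w)
  simp_rw [s1]
  rw [intervalIntegral.integral_of_le hT.le, integral_integral_swap]
  · refine integral_congr_ae ?_
    filter_upwards [hT'] with t ht
    simp_rw [intervalIntegral.integral_of_le hab]
    rw [integral_integral_swap]
    refine (integrable_const (1 : ℝ)).mono' ?_ (.of_forall fun p => hb t ht _)
    exact Continuous.aestronglyMeasurable (by fun_prop)
  · refine (integrable_const (b - a)).mono' ?_ ?_
    · have hc : Continuous fun p : ℝ × ℝ => 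
          ∫ y in a..b, (1 - p.2 / T) * Real.cos (p.2 * (y - p.1)) := by
        apply intervalIntegral.continuous_parametric_intervalIntegral_of_continuous'
        fun_prop
      exact hc.aestronglyMeasurable
    · have := (Measure.quasiMeasurePreserving_snd (μ := μ) (ν := volume.restrict (Set.Ioc 0 T))).ae hT'
      filter_upwards [this] with p hp
      have := intervalIntegral.norm_integral_le_of_norm_le_const (a := a) (b := b) (C := 1)
        (f := fun y => (1 - p.2 / T) * Real.cos (p.2 * (y - p.1))) (fun y _ => hb _ hp _)
      rwa [abs_of_nonneg (by linarith), one_mul] at this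

lemma norm_intervalIntegral_exp_le {t : ℝ} (ht : 0 < t) (a b : ℝ) :
    ‖∫ y in a..b, Complex.exp (-(t * Complex.I) * y)‖ ≤ 2 / t := by
  have hne : -((t : ℂ) * Complex.I) ≠ 0 := by simp [ht.ne']
  rw [integral_exp_mul_complex hne, norm_div]
  have hn : ∀ x : ℝ, ‖Complex.exp (-(t * Complex.I) * x)‖ = 1 := by
    intro x
    have : -(t * Complex.I) * x = ((-(t * x) : ℝ) : ℂ) * Complex.I := by push_cast; ring
    rw [this, Complex.norm_exp_ofReal_mul_I]
  have h2 : ‖-((t : ℂ) * Complex.I)‖ = t := by simp [abs_of_pos ht]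
  rw [h2]
  refine div_le_div_of_nonneg_right ?_ ht.le
  calc _ ≤ _ := norm_sub_le _ _
    _ = 2 := by rw [hn, hn]; norm_num

/-- Two laws whose characteristic functions are close below frequency `T` give nearly the same mass
to intervals, after smoothing by the Fejér kernel. -/
lemma abs_integral_fejerKernel_mul_sub_le (μ ν : Measure ℝ) [IsProbabilityMeasure μ]
    [IsProbabilityMeasure ν] {T : ℝ} (hT : 0 < T) {h : ℝ → ℝ}
    (hh : IntervalIntegrable h volume 0 T)
    (hle : ∀ t, 0 < t → t ≤ T → ‖charFun μ t - charFun ν t‖ ≤ t * h t) {a b : ℝ} (hab : a ≤ b) :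
    |(∫ y, fejerKernel T y * μ.real (Set.Ico (a - y) (b - y))) -
      ∫ y, fejerKernel T y * ν.real (Set.Ico (a - y) (b - y))| ≤ 2 * ∫ t in (0 : ℝ)..T, h t := by
  have hcont : ∀ (ρ : Measure ℝ) [IsProbabilityMeasure ρ], Continuous fun t : ℝ => (1 - t / T) *
        ∫ y in a..b, (Complex.exp (-(t * Complex.I) * y) * charFun ρ t).re := by
    intro ρ _
    have := continuous_charFun (μ := ρ)
    refine Continuous.mul (by fun_prop) ?_
    apply intervalIntegral.continuous_parametric_intervalIntegral_of_continuous'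
    refine Complex.continuous_re.comp (Continuous.mul (by fun_prop) (this.comp continuous_fst))
  rw [integral_fejerKernel_mul_measureReal_Ico μ hT hab,
    integral_fejerKernel_mul_measureReal_Ico ν hT hab,
    integral_intervalIntegral_fejerKernel μ hT hab, integral_intervalIntegral_fejerKernel ν hT hab,
    ← intervalIntegral.integral_sub ((hcont μ).intervalIntegrable _ _)
      ((hcont ν).intervalIntegrable _ _), ← intervalIntegral.integral_const_mul, ← Real.norm_eq_abs]
  refine intervalIntegral.norm_integral_le_of_norm_le hT.le (.of_forall fun t ht => ?_)
    (hh.const_mul 2)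
  have hre : ∀ (ρ : Measure ℝ), IntervalIntegrable
      (fun y : ℝ => (Complex.exp (-(t * Complex.I) * y) * charFun ρ t).re) volume a b := fun ρ =>
    Continuous.intervalIntegrable (by fun_prop) _ _
  have hci : IntervalIntegrable
      (fun y : ℝ => Complex.exp (-(t * Complex.I) * y) * (charFun μ t - charFun ν t)) volume a b :=
    Continuous.intervalIntegrable (by fun_prop) _ _
  rw [← mul_sub, ← intervalIntegral.integral_sub (hre μ) (hre ν), norm_mul]
  have e : ∫ y in a..b, ((Complex.exp (-(t * Complex.I) * y) * charFun μ t).re -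
      (Complex.exp (-(t * Complex.I) * y) * charFun ν t).re) =
      ((∫ y in a..b, Complex.exp (-(t * Complex.I) * y)) * (charFun μ t - charFun ν t)).re := by
    rw [← intervalIntegral.integral_mul_const]
    have := Complex.reCLM.intervalIntegral_comp_comm hci
    simp only [Complex.reCLM_apply] at this
    rw [← this]
    simp_rw [mul_sub, Complex.sub_re]
  rw [e]
  have h1 : ‖1 - t / T‖ ≤ 1 := by
    have := div_nonneg ht.1.le hT.le
    have := (div_le_one hT).2 ht.2
    rw [Real.norm_eq_abs, abs_le]; constructor <;> linarith
  calc ‖1 - t / T‖ * ‖((∫ y in a..b, Complex.exp (-(t * Complex.I) * y)) *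
        (charFun μ t - charFun ν t)).re‖
      ≤ 1 * (2 / t * (t * h t)) := by
        refine mul_le_mul h1 ?_ (norm_nonneg _) zero_le_one
        refine (Complex.abs_re_le_norm _).trans ?_
        rw [norm_mul]
        exact mul_le_mul (norm_intervalIntegral_exp_le ht.1 a b) (hle t ht.1 ht.2) (norm_nonneg _)
          (div_nonneg zero_le_two ht.1.le)
    _ = 2 * h t := by have := ht.1.ne'; field_simp

lemma monotone_measureReal_Iio (μ : Measure ℝ) [IsProbabilityMeasure μ] :
    Monotone fun x => μ.real (Set.Iio x) := fun _ _ h =>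
  measureReal_mono (Set.Iio_subset_Iio h)

lemma tendsto_measureReal_Iio_atBot (μ : Measure ℝ) [IsProbabilityMeasure μ] :
    Filter.Tendsto (fun x => μ.real (Set.Iio x)) Filter.atBot (nhds 0) :=
  tendsto_of_tendsto_of_tendsto_of_le_of_le tendsto_const_nhds (tendsto_cdf_atBot μ)
    (fun _ => measureReal_nonneg) (fun x => by
      rw [cdf_eq_real]; exact measureReal_mono Set.Iio_subset_Iic_self)

lemma integrable_fejerKernel_mul_measureReal_Iio (μ : Measure ℝ) [IsProbabilityMeasure μ]
    {T : ℝ} (hT : 0 < T) (b : ℝ) :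
    Integrable fun y => fejerKernel T y * μ.real (Set.Iio (b - y)) := by
  refine (integrable_fejerKernel hT).mul_bdd (c := 1) ?_ (.of_forall fun y => ?_)
  · exact ((monotone_measureReal_Iio μ).measurable.comp (by fun_prop)).aestronglyMeasurable
  · rw [Real.norm_of_nonneg measureReal_nonneg]; exact measureReal_le_one

/-- The bound on smoothed masses of intervals does not depend on the left endpoint, which is sent
to `-∞`. -/
lemma abs_integral_fejerKernel_mul_sub_Iio_le (μ ν : Measure ℝ) [IsProbabilityMeasure μ]
    [IsProbabilityMeasure ν] {T : ℝ} (hT : 0 < T) {h : ℝ → ℝ}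
    (hh : IntervalIntegrable h volume 0 T)
    (hle : ∀ t, 0 < t → t ≤ T → ‖charFun μ t - charFun ν t‖ ≤ t * h t) (b : ℝ) :
    |∫ y, fejerKernel T y * (μ.real (Set.Iio (b - y)) - ν.real (Set.Iio (b - y)))|
      ≤ 2 * ∫ t in (0 : ℝ)..T, h t := by
  have hlim : ∀ (ρ : Measure ℝ) [IsProbabilityMeasure ρ], Filter.Tendsto
      (fun a => ∫ y, fejerKernel T y * ρ.real (Set.Ico (a - y) (b - y))) Filter.atBot
      (nhds (∫ y, fejerKernel T y * ρ.real (Set.Iio (b - y)))) := by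
    intro ρ _
    have h0 : Filter.Tendsto (fun a => ∫ y, fejerKernel T y * ρ.real (Set.Iio (a - y)))
        Filter.atBot (nhds 0) := by
      have : (0 : ℝ) = ∫ y : ℝ, (0 : ℝ) := by simp
      rw [this]
      refine tendsto_integral_filter_of_dominated_convergence (fejerKernel T)
        (.of_forall fun a => (integrable_fejerKernel_mul_measureReal_Iio ρ hT a).1)
        (.of_forall fun a => .of_forall fun y => ?_) (integrable_fejerKernel hT)
        (.of_forall fun y => ?_)
      · rw [Real.norm_of_nonneg (mul_nonneg (fejerKernel_nonneg hT y) measureReal_nonneg)]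
        exact mul_le_of_le_one_right (fejerKernel_nonneg hT y) measureReal_le_one
      · have := (tendsto_measureReal_Iio_atBot ρ).comp
          (Filter.tendsto_atBot_add_const_right _ (-y) Filter.tendsto_id)
        simpa [sub_eq_add_neg] using this.const_mul (fejerKernel T y)
    have h1 := h0.const_sub (∫ y, fejerKernel T y * ρ.real (Set.Iio (b - y)))
    rw [sub_zero] at h1
    refine h1.congr' ?_
    filter_upwards [Filter.eventually_le_atBot b] with a hab
    rw [← integral_sub (integrable_fejerKernel_mul_measureReal_Iio ρ hT b)
      (integrable_fejerKernel_mul_measureReal_Iio ρ hT a)]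
    congr 1
    ext y
    rw [← mul_sub, ← Set.Iio_sdiff_Iio,
      measureReal_sdiff (Set.Iio_subset_Iio (by linarith)) measurableSet_Iio]
  simp_rw [mul_sub]
  rw [integral_sub (integrable_fejerKernel_mul_measureReal_Iio μ hT b)
      (integrable_fejerKernel_mul_measureReal_Iio ν hT b)]
  refine le_of_tendsto ((hlim μ).sub (hlim ν)).abs ?_
  filter_upwards [Filter.eventually_le_atBot b] with a hab
  exact abs_integral_fejerKernel_mul_sub_le μ ν hT hh hle hab

/-- Unsmoothing: a bounded function which is large at one point, and does not drop much in a
one-sided neighbourhood of it, has a large average against the Fejér kernel. -/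
lemma mul_le_integral_fejerKernel_mul {T a c : ℝ} (hT : 0 < T) (ha : 0 < a)
    (hc : c = ∫ y, fejerKernel 1 y)
    (hwin : 3 / 4 * c ≤ ∫ y in (-(a / T))..(a / T), fejerKernel T y)
    {D : ℝ → ℝ} (hD : Integrable fun y => fejerKernel T y * D y) {Δ e : ℝ} (hΔ : ∀ y, -Δ ≤ D y)
    (he : 0 ≤ e + Δ) (hDe : ∀ y, |y| ≤ a / T → e ≤ D y) :
    c * (3 / 4 * e - Δ / 4) ≤ ∫ y, fejerKernel T y * D y := by
  have hk := integrable_fejerKernel hT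
  have hI : Integrable fun y => (e + Δ) * (Set.Ioc (-(a / T)) (a / T)).indicator (fejerKernel T) y :=
    (hk.indicator measurableSet_Ioc).const_mul _
  have hpos : 0 < a / T := by positivity
  have hval : ∫ y, (fejerKernel T y * (-Δ) +
      (e + Δ) * (Set.Ioc (-(a / T)) (a / T)).indicator (fejerKernel T) y) =
      c * (-Δ) + (e + Δ) * ∫ y in (-(a / T))..(a / T), fejerKernel T y := by
    rw [integral_add (hk.mul_const _) hI, integral_mul_const, integral_const_mul,
      integral_indicator measurableSet_Ioc, intervalIntegral.integral_of_le (by linarith),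
      integral_fejerKernel hT, hc]
  have hle : ∫ y, (fejerKernel T y * (-Δ) +
      (e + Δ) * (Set.Ioc (-(a / T)) (a / T)).indicator (fejerKernel T) y) ≤
      ∫ y, fejerKernel T y * D y := by
    refine integral_mono ((hk.mul_const _).add hI) hD fun y => ?_
    have hy := fejerKernel_nonneg hT y
    simp only
    by_cases hmem : y ∈ Set.Ioc (-(a / T)) (a / T)
    · rw [Set.indicator_of_mem hmem]
      have := hDe y (abs_le.2 ⟨hmem.1.le, hmem.2⟩)
      nlinarith
    · rw [Set.indicator_of_notMem hmem]
      have := hΔ y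
      nlinarith
  rw [hval] at hle
  have := mul_le_mul_of_nonneg_left hwin he
  linarith

/-- **Esseen's smoothing inequality**: the Kolmogorov distance to a law with `1`-Lipschitz
distribution function is controlled by the characteristic functions at frequencies up to `T`. -/
theorem exists_esseen_smoothing : ∃ K : ℝ, 0 < K ∧ ∀ (μ ν : Measure ℝ) [IsProbabilityMeasure μ]
    [IsProbabilityMeasure ν] (_ : ∀ x y : ℝ, x ≤ y → ν.real (Set.Iio y) - ν.real (Set.Iio x) ≤ y - x)
    (T : ℝ) (_ : 0 < T) (h : ℝ → ℝ) (_ : IntervalIntegrable h volume 0 T)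
    (_ : ∀ t, 0 < t → t ≤ T → ‖charFun μ t - charFun ν t‖ ≤ t * h t) (x : ℝ),
    |μ.real (Set.Iio x) - ν.real (Set.Iio x)| ≤ K * ((∫ t in (0 : ℝ)..T, h t) + 1 / T) := by
  obtain ⟨a, ha, hwin⟩ := exists_fejerKernel_window
  set c := ∫ y, fejerKernel 1 y with hc
  have hcpos : 0 < c := integral_fejerKernel_pos
  refine ⟨4 / c + 3 * a, by positivity, fun μ ν _ _ hLip T hT h hh hle x => ?_⟩
  set η := 2 * ∫ t in (0 : ℝ)..T, h t with hη
  set D : ℝ → ℝ := fun x => μ.real (Set.Iio x) - ν.real (Set.Iio x) with hDdef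
  have hb : ∀ b, |∫ y, fejerKernel T y * D (b - y)| ≤ η := fun b =>
    abs_integral_fejerKernel_mul_sub_Iio_le μ ν hT hh hle b
  have hη0 : 0 ≤ η := (abs_nonneg _).trans (hb 0)
  have hInt : ∀ b, Integrable fun y => fejerKernel T y * D (b - y) := fun b => by
    simp only [hDdef, mul_sub]
    exact (integrable_fejerKernel_mul_measureReal_Iio μ hT b).sub
      (integrable_fejerKernel_mul_measureReal_Iio ν hT b)
  have hbdd : BddAbove (Set.range fun x => |D x|) := by
    refine ⟨1, ?_⟩
    rintro _ ⟨y, rfl⟩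
    have h1 := measureReal_le_one (μ := μ) (s := Set.Iio y)
    have h2 := measureReal_le_one (μ := ν) (s := Set.Iio y)
    have h3 := measureReal_nonneg (μ := μ) (s := Set.Iio y)
    have h4 := measureReal_nonneg (μ := ν) (s := Set.Iio y)
    exact abs_le.2 ⟨by simp only [hDdef]; linarith, by simp only [hDdef]; linarith⟩
  set Δ := ⨆ x, |D x| with hΔdef
  have hΔ : ∀ y, |D y| ≤ Δ := fun y => le_ciSup hbdd y
  have hΔ0 : 0 ≤ Δ := (abs_nonneg _).trans (hΔ 0)
  have hw : 0 < a / T := by positivity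
  have main : ∀ x, |D x| ≤ 2 * (a / T) + 4 / 3 * (η / c) + Δ / 3 := by
    intro x
    -- monotonicity of the first distribution function keeps `D` large to the right of `x`
    have hup : D x ≤ 2 * (a / T) + 4 / 3 * (η / c) + Δ / 3 := by
      by_cases hd : D x - 2 * (a / T) ≤ 0
      · have : 0 ≤ 4 / 3 * (η / c) + Δ / 3 := by positivity
        linarith
      have h1 := mul_le_integral_fejerKernel_mul hT ha hc (hwin T hT) (hInt (x + a / T)) (Δ := Δ)
        (e := D x - 2 * (a / T)) (fun y => neg_le_of_abs_le (hΔ _)) (by linarith) (by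
          intro y hy
          rw [abs_le] at hy
          have e1 := monotone_measureReal_Iio μ (show x ≤ x + a / T - y by linarith)
          have e2 := hLip x (x + a / T - y) (by linarith)
          simp only [hDdef] at e1 ⊢
          linarith)
      have h2 := h1.trans (le_of_abs_le (hb _))
      rw [mul_comm, ← le_div_iff₀ hcpos] at h2
      linarith
    have hdown : -D x ≤ 2 * (a / T) + 4 / 3 * (η / c) + Δ / 3 := by
      by_cases hd : -D x - 2 * (a / T) ≤ 0
      · have : 0 ≤ 4 / 3 * (η / c) + Δ / 3 := by positivity
        linarith
      have h1 := mul_le_integral_fejerKernel_mul hT ha hc (hwin T hT)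
        (D := fun y => -D (x - a / T - y)) (by simpa using (hInt (x - a / T)).neg) (Δ := Δ)
        (e := -D x - 2 * (a / T)) (fun y => neg_le_neg (le_of_abs_le (hΔ _))) (by linarith) (by
          intro y hy
          rw [abs_le] at hy
          have e1 := monotone_measureReal_Iio μ (show x - a / T - y ≤ x by linarith)
          have e2 := hLip (x - a / T - y) x (by linarith)
          simp only [hDdef] at e1 ⊢
          linarith)
      simp only [mul_neg, integral_neg] at h1
      have h2 := h1.trans (neg_le.1 (neg_le_of_abs_le (hb (x - a / T))))
      rw [mul_comm, ← le_div_iff₀ hcpos] at h2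
      linarith
    exact abs_le'.2 ⟨hup, hdown⟩
  have hfin : Δ ≤ 2 * (a / T) + 4 / 3 * (η / c) + Δ / 3 := ciSup_le main
  have hI0 : 0 ≤ ∫ t in (0 : ℝ)..T, h t := by linarith
  have e : (4 / c + 3 * a) * ((∫ t in (0 : ℝ)..T, h t) + 1 / T)
      = 2 * (η / c) + 3 * (a / T) + (4 / c / T + 3 * a * ∫ t in (0 : ℝ)..T, h t) := by
    rw [hη]; field_simp; ring
  have : 0 ≤ 4 / c / T + 3 * a * ∫ t in (0 : ℝ)..T, h t := by positivity
  rw [e]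
  exact (hΔ x).trans (by linarith)

/-! ### A Berry–Esseen bound for weighted sums -/

lemma norm_exp_mul_I_sub_taylor_le (x : ℝ) :
    ‖Complex.exp (x * Complex.I) - (1 + x * Complex.I - x ^ 2 / 2)‖ ≤ 5 / 2 * |x| ^ 3 := by
  rcases le_or_gt |x| 1 with hx | hx
  · have h := Complex.exp_bound (x := x * Complex.I) (by simpa using hx) (n := 3) (by norm_num)
    have e : ∑ m ∈ Finset.range 3, ((x : ℂ) * Complex.I) ^ m / (m.factorial : ℂ) =
        1 + x * Complex.I - x ^ 2 / 2 := by
      simp only [Finset.sum_range_succ, Finset.sum_range_zero, mul_pow, Complex.I_sq,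
        Nat.factorial]
      push_cast
      ring
    rw [e] at h
    refine h.trans ?_
    have : ‖(x : ℂ) * Complex.I‖ = |x| := by simp
    rw [this, mul_comm]
    refine mul_le_mul_of_nonneg_right ?_ (by positivity)
    norm_num [Nat.factorial]
  · have h1 : ‖Complex.exp (x * Complex.I) - 1‖ ≤ |x| := by
      have := Real.norm_exp_I_mul_ofReal_sub_one_le (x := x)
      rwa [mul_comm, Real.norm_eq_abs] at this
    have h2 : ‖(x : ℂ) * Complex.I‖ = |x| := by simp
    have h3 : ‖(x : ℂ) ^ 2 / 2‖ = |x| ^ 2 / 2 := by simp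
    calc _ = ‖(Complex.exp (x * Complex.I) - 1) - x * Complex.I + x ^ 2 / 2‖ := by congr 1; ring
      _ ≤ |x| + |x| + |x| ^ 2 / 2 := by
        refine (norm_add_le _ _).trans (add_le_add ((norm_sub_le _ _).trans ?_) h3.le)
        exact add_le_add h1 h2.le
      _ ≤ _ := by
        have e1 : |x| ≤ |x| ^ 3 := le_self_pow₀ hx.le (by norm_num)
        have e2 : |x| ^ 2 ≤ |x| ^ 3 := pow_le_pow_right₀ hx.le (by norm_num)
        linarith

section SingleLaw
variable {μ : Measure ℝ} {C : ℝ}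

lemma integrable_abs_pow_three (h3 : MemLp id 3 μ) : Integrable (fun x => |x| ^ 3) μ := by
  have := h3.integrable_norm_pow (p := 3) (by norm_num)
  simpa using this

variable [IsProbabilityMeasure μ]

lemma integrable_sq_of_memLp_three (h3 : MemLp id 3 μ) : Integrable (fun x : ℝ => x ^ 2) μ :=
  (h3.mono_exponent (by norm_num : (2 : ENNReal) ≤ 3)).integrable_sq

lemma one_le_of_integral_abs_pow_three_le (h3 : MemLp id 3 μ) (hx2 : ∫ x, x ^ 2 ∂μ = 1)
    (hC : ∫ x, |x| ^ 3 ∂μ ≤ C) : 1 ≤ C := by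
  have hi := integrable_abs_pow_three h3
  have h : ∫ x, 3 * x ^ 2 ∂μ ≤ ∫ x, (2 * |x| ^ 3 + 1) ∂μ := by
    refine integral_mono ((integrable_sq_of_memLp_three h3).const_mul 3)
      ((hi.const_mul 2).add (integrable_const 1)) fun x => ?_
    simp only
    rw [← sq_abs]
    nlinarith [sq_nonneg (|x| - 1), abs_nonneg x, mul_nonneg (abs_nonneg x) (sq_nonneg (|x| - 1))]
  rw [integral_const_mul, hx2, integral_add (hi.const_mul 2) (integrable_const 1),
    integral_const_mul] at h
  simp at h
  linarith

lemma norm_charFun_sub_taylor_le (h3 : MemLp id 3 μ) (hx1 : ∫ x, x ∂μ = 0)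
    (hx2 : ∫ x, x ^ 2 ∂μ = 1) (hC : ∫ x, |x| ^ 3 ∂μ ≤ C) (s : ℝ) :
    ‖charFun μ s - ((1 - s ^ 2 / 2 : ℝ) : ℂ)‖ ≤ 5 / 2 * C * |s| ^ 3 := by
  have hi1 : Integrable (fun x : ℝ => x) μ := h3.integrable (by norm_num)
  have hi2 := integrable_sq_of_memLp_three h3
  have hi3 := integrable_abs_pow_three h3
  have hexp : Integrable (fun x : ℝ => Complex.exp ((s * x : ℝ) * Complex.I)) μ := by
    refine (integrable_const (1 : ℝ)).mono' (by fun_prop) (.of_forall fun w => ?_)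
    rw [Complex.norm_exp_ofReal_mul_I]
  have hc1 : Integrable (fun x : ℝ => ((s * x : ℝ) : ℂ) * Complex.I) μ :=
    (hi1.const_mul s).ofReal.mul_const _
  have hc2 : Integrable (fun x : ℝ => ((s * x : ℝ) : ℂ) ^ 2 / 2) μ := by
    have := ((hi2.const_mul (s ^ 2 / 2)).ofReal (𝕜 := ℂ))
    refine this.congr (.of_forall fun x => ?_)
    simp only [RCLike.ofReal_eq_complex_ofReal]; push_cast; ring
  have hc0 : Integrable (fun _ : ℝ => (1 : ℂ)) μ := integrable_const 1
  have e : charFun μ s - ((1 - s ^ 2 / 2 : ℝ) : ℂ) = ∫ x, (Complex.exp ((s * x : ℝ) * Complex.I) -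
      (1 + (s * x : ℝ) * Complex.I - ((s * x : ℝ) : ℂ) ^ 2 / 2)) ∂μ := by
    have hc01 : Integrable (fun x : ℝ => 1 + ((s * x : ℝ) : ℂ) * Complex.I) μ := hc0.add hc1
    have hc012 : Integrable
        (fun x : ℝ => 1 + ((s * x : ℝ) : ℂ) * Complex.I - ((s * x : ℝ) : ℂ) ^ 2 / 2) μ :=
      hc01.sub hc2
    rw [integral_sub hexp hc012, integral_sub hc01 hc2, integral_add hc0 hc1]
    have e1 : ∫ x : ℝ, ((s * x : ℝ) : ℂ) * Complex.I ∂μ = 0 := by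
      rw [integral_mul_const, integral_complex_ofReal, integral_const_mul, hx1]; simp
    have e2 : ∫ x : ℝ, ((s * x : ℝ) : ℂ) ^ 2 / 2 ∂μ = ((s ^ 2 / 2 : ℝ) : ℂ) := by
      have : (fun x : ℝ => ((s * x : ℝ) : ℂ) ^ 2 / 2) = fun x : ℝ => ((s ^ 2 / 2 * x ^ 2 : ℝ) : ℂ) := by
        ext x; push_cast; ring
      rw [this, integral_complex_ofReal, integral_const_mul, hx2, mul_one]
    rw [e1, e2, charFun_apply_real]
    simp
  rw [e]
  calc _ ≤ ∫ x, 5 / 2 * |s| ^ 3 * |x| ^ 3 ∂μ := by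
        refine norm_integral_le_of_norm_le (hi3.const_mul _) (.of_forall fun x => ?_)
        refine (norm_exp_mul_I_sub_taylor_le (s * x)).trans_eq ?_
        rw [abs_mul]; ring
    _ = 5 / 2 * |s| ^ 3 * ∫ x, |x| ^ 3 ∂μ := integral_const_mul _ _
    _ ≤ 5 / 2 * |s| ^ 3 * C := mul_le_mul_of_nonneg_left hC (by positivity)
    _ = _ := by ring

lemma norm_charFun_le_exp (h3 : MemLp id 3 μ) (hx1 : ∫ x, x ∂μ = 0)
    (hx2 : ∫ x, x ^ 2 ∂μ = 1) (hC : ∫ x, |x| ^ 3 ∂μ ≤ C) (s : ℝ) :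
    ‖charFun μ s‖ ≤ Real.exp (-(s ^ 2 / 2) + 5 / 2 * C * |s| ^ 3) := by
  have hC1 := one_le_of_integral_abs_pow_three_le h3 hx2 hC
  rcases le_or_gt (s ^ 2) 2 with hs | hs
  · have h := norm_charFun_sub_taylor_le h3 hx1 hx2 hC s
    have h1 : ‖((1 - s ^ 2 / 2 : ℝ) : ℂ)‖ = 1 - s ^ 2 / 2 := by
      rw [Complex.norm_real, Real.norm_of_nonneg]; linarith
    have h2 : ‖charFun μ s‖ ≤ ‖((1 - s ^ 2 / 2 : ℝ) : ℂ)‖ +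
        ‖charFun μ s - ((1 - s ^ 2 / 2 : ℝ) : ℂ)‖ := by
      have := norm_add_le ((1 - s ^ 2 / 2 : ℝ) : ℂ) (charFun μ s - ((1 - s ^ 2 / 2 : ℝ) : ℂ))
      rwa [add_sub_cancel] at this
    have h4 := Real.add_one_le_exp (-(s ^ 2 / 2) + 5 / 2 * C * |s| ^ 3)
    linarith
  · -- for `s² > 2` the exponent is nonnegative, because `C ≥ 1`
    refine (norm_charFun_le_one s).trans (Real.one_le_exp ?_)
    have hs1 : 1 ≤ |s| := by
      by_contra! hlt
      have : |s| ^ 2 < 1 := pow_lt_one₀ (abs_nonneg s) hlt (by norm_num)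
      rw [sq_abs] at this
      linarith
    have h2 : |s| ^ 2 ≤ |s| ^ 3 := pow_le_pow_right₀ hs1 (by norm_num)
    rw [sq_abs] at h2
    nlinarith [sq_nonneg s]

lemma norm_charFun_sub_exp_le (h3 : MemLp id 3 μ) (hx1 : ∫ x, x ∂μ = 0)
    (hx2 : ∫ x, x ^ 2 ∂μ = 1) (hC : ∫ x, |x| ^ 3 ∂μ ≤ C) (s : ℝ) :
    ‖charFun μ s - (Real.exp (-(s ^ 2 / 2)) : ℂ)‖ ≤ 5 * C * |s| ^ 3 := by
  have hC1 := one_le_of_integral_abs_pow_three_le h3 hx2 hC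
  have h := norm_charFun_sub_taylor_le h3 hx1 hx2 hC s
  have h2 : |Real.exp (-(s ^ 2 / 2)) - (1 - s ^ 2 / 2)| ≤ |s| ^ 3 := by
    have hl := Real.add_one_le_exp (-(s ^ 2 / 2))
    rw [abs_of_nonneg (by linarith)]
    rcases le_or_gt |s| 1 with hs | hs
    · have hsq : s ^ 2 ≤ 1 := by rw [← sq_abs]; exact pow_le_one₀ (abs_nonneg s) hs
      have hb := (abs_le.1 (Real.abs_exp_sub_one_sub_id_le (x := -(s ^ 2 / 2)) (by
        rw [abs_neg, abs_of_nonneg (by positivity)]; linarith))).2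
      have : |s| ^ 4 ≤ |s| ^ 3 := pow_le_pow_of_le_one (abs_nonneg s) hs (by norm_num)
      have e : |s| ^ 4 = (s ^ 2) ^ 2 := by rw [← sq_abs s]; ring
      nlinarith [sq_nonneg (s ^ 2)]
    · have h2 : |s| ^ 2 ≤ |s| ^ 3 := pow_le_pow_right₀ hs.le (by norm_num)
      rw [sq_abs] at h2
      have : Real.exp (-(s ^ 2 / 2)) ≤ 1 := Real.exp_le_one_iff.2 (by nlinarith [sq_nonneg s])
      nlinarith [sq_nonneg s]
  have h3' : ‖((1 - s ^ 2 / 2 : ℝ) : ℂ) - (Real.exp (-(s ^ 2 / 2)) : ℂ)‖ ≤ |s| ^ 3 := by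
    rw [← Complex.ofReal_sub, Complex.norm_real, norm_sub_rev]
    exact h2
  have := norm_sub_le_norm_sub_add_norm_sub (charFun μ s) ((1 - s ^ 2 / 2 : ℝ) : ℂ)
    (Real.exp (-(s ^ 2 / 2)) : ℂ)
  have h5 : 0 ≤ |s| ^ 3 := by positivity
  nlinarith

end SingleLaw

/-- Telescoping estimate for the difference of two products whose factors are bounded by `M i`. -/
lemma norm_prod_sub_prod_le {ι : Type*} (s : Finset ι) (a b : ι → ℂ) (M : ι → ℝ)
    (hM : ∀ i, 0 < M i) (ha : ∀ i, ‖a i‖ ≤ M i) (hb : ∀ i, ‖b i‖ ≤ M i) :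
    ‖∏ i ∈ s, a i - ∏ i ∈ s, b i‖ ≤ (∑ i ∈ s, ‖a i - b i‖ / M i) * ∏ i ∈ s, M i := by
  classical
  induction s using Finset.induction_on with
  | empty => simp
  | insert i s hi ih =>
    rw [Finset.prod_insert hi, Finset.prod_insert hi, Finset.sum_insert hi, Finset.prod_insert hi]
    have e : a i * ∏ j ∈ s, a j - b i * ∏ j ∈ s, b j =
        (a i - b i) * ∏ j ∈ s, a j + b i * (∏ j ∈ s, a j - ∏ j ∈ s, b j) := by ring
    rw [e]
    have hA : ‖∏ j ∈ s, a j‖ ≤ ∏ j ∈ s, M j := by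
      rw [norm_prod]; exact Finset.prod_le_prod (fun _ _ => norm_nonneg _) fun j _ => ha j
    calc _ ≤ ‖a i - b i‖ * ∏ j ∈ s, M j +
          M i * ((∑ j ∈ s, ‖a j - b j‖ / M j) * ∏ j ∈ s, M j) := by
          refine (norm_add_le _ _).trans (add_le_add ?_ ?_)
          · rw [norm_mul]; exact mul_le_mul_of_nonneg_left hA (norm_nonneg _)
          · rw [norm_mul]
            exact mul_le_mul (hb i) ih (norm_nonneg _) (hM i).le
      _ = _ := by have := (hM i).ne'; field_simp

lemma gaussianReal_real_Iio_sub_le {x y : ℝ} (hxy : x ≤ y) :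
    (gaussianReal 0 1).real (Set.Iio y) - (gaussianReal 0 1).real (Set.Iio x) ≤ y - x := by
  rw [← measureReal_sdiff (Set.Iio_subset_Iio hxy) measurableSet_Iio, Set.Iio_sdiff_Iio, measureReal_def,
    gaussianReal_apply_eq_integral 0 one_ne_zero,
    ENNReal.toReal_ofReal (integral_nonneg fun z => gaussianPDFReal_nonneg 0 1 z)]
  have hle : ∀ z, gaussianPDFReal 0 1 z ≤ 1 := by
    intro z
    rw [gaussianPDFReal]
    have h1 : (√(2 * Real.pi * ((1 : NNReal) : ℝ)))⁻¹ ≤ 1 := by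
      apply inv_le_one_of_one_le₀
      rw [Real.one_le_sqrt]
      have := Real.pi_gt_three
      simp; linarith
    have h2 : Real.exp (-(z - 0) ^ 2 / (2 * ((1 : NNReal) : ℝ))) ≤ 1 :=
      Real.exp_le_one_iff.2 (div_nonpos_of_nonpos_of_nonneg (by nlinarith [sq_nonneg (z - 0)]) (by simp))
    exact mul_le_one₀ h1 (Real.exp_pos _).le h2
  calc _ ≤ ∫ z in Set.Ico x y, (1 : ℝ) :=
        setIntegral_mono (integrable_gaussianPDFReal 0 1).integrableOn (by simp) hle
    _ = y - x := by simp [hxy]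

lemma charFun_map_sum_mul {ι : Type*} [Fintype ι] (μ : ι → Measure ℝ)
    [∀ i, IsProbabilityMeasure (μ i)] (v : ι → ℝ) (t : ℝ) :
    charFun ((Measure.pi μ).map fun x => ∑ i, x i * v i) t = ∏ i, charFun (μ i) (t * v i) := by
  have hm : Measurable fun x : ι → ℝ => ∑ i, x i * v i := by fun_prop
  rw [charFun_apply_real, integral_map hm.aemeasurable (by fun_prop)]
  simp_rw [charFun_apply_real]
  rw [← integral_fintype_prod_eq_prod (fun i (x : ℝ) => Complex.exp ((t * v i : ℝ) * x * Complex.I))]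
  congr 1
  ext x
  rw [← Complex.exp_sum]
  congr 1
  push_cast
  rw [Finset.mul_sum, Finset.sum_mul]
  exact Finset.sum_congr rfl fun i _ => by ring

/-- If the total weight `τ` is near one and the third-order quantity `L` is small, the
characteristic function of a weighted sum is close to that of the standard Gaussian, on a window
of frequencies of length inversely proportional to `L`. -/
lemma norm_prod_charFun_sub_le {ι : Type*} [Fintype ι] (μ : ι → Measure ℝ)
    [∀ i, IsProbabilityMeasure (μ i)] {C : ℝ} (h3 : ∀ i, MemLp id 3 (μ i))
    (hx1 : ∀ i, ∫ x, x ∂(μ i) = 0) (hx2 : ∀ i, ∫ x, x ^ 2 ∂(μ i) = 1)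
    (hC : ∀ i, ∫ x, |x| ^ 3 ∂(μ i) ≤ C) (hC1 : 1 ≤ C) (v : ι → ℝ) {L τ : ℝ}
    (hL : L = 5 * C * ∑ i, |v i| ^ 3) (hτ : τ = ∑ i, v i ^ 2) (hτ1 : |τ - 1| ≤ 1 / 2)
    (hL1 : L ≤ 1 / 64) {t : ℝ} (ht : 0 ≤ t) (htL : 8 * L * t ≤ 1) :
    ‖(∏ i, charFun (μ i) (t * v i)) - (Real.exp (-(t ^ 2 / 2)) : ℂ)‖ ≤
      (L * t ^ 3 + |τ - 1| * t ^ 2) * Real.exp (-(t ^ 2 / 8)) := by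
  classical
  set M : ι → ℝ := fun i => Real.exp (-((t * v i) ^ 2 / 2) + 5 / 2 * C * |t * v i| ^ 3) with hM
  have hprodM : ∏ i, M i = Real.exp (-(τ * t ^ 2 / 2) + L / 2 * t ^ 3) := by
    rw [hM, ← Real.exp_sum]
    congr 1
    rw [hτ, hL, Finset.sum_add_distrib, Finset.sum_mul, Finset.sum_div, ← Finset.sum_neg_distrib,
      Finset.mul_sum, Finset.sum_div, Finset.sum_mul]
    congr 1 <;> refine Finset.sum_congr rfl fun i _ => ?_
    · ring
    · rw [abs_mul, abs_of_nonneg ht]; ring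
  have hb : ∏ i, (Real.exp (-((t * v i) ^ 2 / 2)) : ℂ) = (Real.exp (-(τ * t ^ 2 / 2)) : ℂ) := by
    rw [← Complex.ofReal_prod, ← Real.exp_sum]
    congr 2
    rw [hτ, Finset.sum_neg_distrib, Finset.sum_mul, Finset.sum_div]
    congr 1
    refine Finset.sum_congr rfl fun i _ => by ring
  have hL0 : 0 ≤ L := by rw [hL]; positivity
  have hv : ∀ i, v i ^ 2 ≤ 1 / 16 := by
    intro i
    have h1 : |v i| ^ 3 ≤ 1 / 64 := by
      have : |v i| ^ 3 ≤ ∑ i, |v i| ^ 3 :=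
        Finset.single_le_sum (f := fun i => |v i| ^ 3) (fun i _ => by positivity) (Finset.mem_univ i)
      have h2 : 1 * |v i| ^ 3 ≤ 5 * C * ∑ i, |v i| ^ 3 :=
        mul_le_mul (by linarith) this (by positivity) (by linarith)
      linarith
    have h2 : |v i| ≤ 1 / 4 := by
      by_contra! hlt
      have : (1 / 4 : ℝ) ^ 3 < |v i| ^ 3 := pow_lt_pow_left₀ hlt (by norm_num) (by norm_num)
      norm_num at this; linarith
    rw [← sq_abs]
    nlinarith [abs_nonneg (v i)]
  have htel := norm_prod_sub_prod_le Finset.univ (fun i => charFun (μ i) (t * v i))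
    (fun i => (Real.exp (-((t * v i) ^ 2 / 2)) : ℂ)) M (fun i => Real.exp_pos _)
    (fun i => norm_charFun_le_exp (h3 i) (hx1 i) (hx2 i) (hC i) _) (fun i => by
      rw [Complex.norm_real, Real.norm_of_nonneg (Real.exp_pos _).le]
      refine Real.exp_le_exp.2 ?_
      have : 0 ≤ 5 / 2 * C * |t * v i| ^ 3 := by positivity
      linarith)
  have hsum : ∑ i, ‖charFun (μ i) (t * v i) - (Real.exp (-((t * v i) ^ 2 / 2)) : ℂ)‖ / M i ≤
      L * t ^ 3 * Real.exp (t ^ 2 / 32) := by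
    have : ∀ i, ‖charFun (μ i) (t * v i) - (Real.exp (-((t * v i) ^ 2 / 2)) : ℂ)‖ / M i ≤
        5 * C * |v i| ^ 3 * t ^ 3 * Real.exp (t ^ 2 / 32) := by
      intro i
      rw [div_eq_mul_inv, hM, ← Real.exp_neg]
      refine mul_le_mul ?_ ?_ (Real.exp_pos _).le (by positivity)
      · refine (norm_charFun_sub_exp_le (h3 i) (hx1 i) (hx2 i) (hC i) _).trans_eq ?_
        rw [abs_mul, abs_of_nonneg ht]; ring
      · refine Real.exp_le_exp.2 ?_
        have : 0 ≤ 5 / 2 * C * |t * v i| ^ 3 := by positivity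
        nlinarith [hv i, sq_nonneg t]
    refine (Finset.sum_le_sum fun i _ => this i).trans_eq ?_
    rw [← Finset.sum_mul, ← Finset.sum_mul, ← Finset.mul_sum, ← hL]
  have hτ' := abs_le.1 hτ1
  have hLt : L / 2 * t ^ 3 ≤ t ^ 2 / 16 := by nlinarith [sq_nonneg t]
  have h1 : ‖(∏ i, charFun (μ i) (t * v i)) - (Real.exp (-(τ * t ^ 2 / 2)) : ℂ)‖ ≤
      L * t ^ 3 * Real.exp (-(t ^ 2 / 8)) := by
    rw [← hb]
    refine htel.trans ((mul_le_mul_of_nonneg_right hsum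
      (Finset.prod_nonneg fun i _ => (Real.exp_pos _).le)).trans ?_)
    rw [hprodM, mul_assoc, ← Real.exp_add]
    refine mul_le_mul_of_nonneg_left (Real.exp_le_exp.2 ?_) (by positivity)
    nlinarith [sq_nonneg t]
  have h2 : ‖(Real.exp (-(τ * t ^ 2 / 2)) : ℂ) - (Real.exp (-(t ^ 2 / 2)) : ℂ)‖ ≤
      |τ - 1| * t ^ 2 * Real.exp (-(t ^ 2 / 8)) := by
    rw [← Complex.ofReal_sub, Complex.norm_real, Real.norm_eq_abs]
    have hconv : ∀ x y : ℝ, t ^ 2 / 4 ≤ x → x ≤ y →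
        |Real.exp (-x) - Real.exp (-y)| ≤ (y - x) * Real.exp (-(t ^ 2 / 8)) := by
      intro x y hx hxy
      rw [abs_of_nonneg (sub_nonneg.2 (Real.exp_le_exp.2 (by linarith)))]
      have e : Real.exp (-x) - Real.exp (-y) = Real.exp (-x) * (1 - Real.exp (-(y - x))) := by
        rw [mul_sub, ← Real.exp_add]; ring_nf
      rw [e, mul_comm]
      refine mul_le_mul ?_ (Real.exp_le_exp.2 (by nlinarith [sq_nonneg t])) (Real.exp_pos _).le
        (by linarith)
      have := Real.one_sub_le_exp_neg (y - x)
      linarith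
    have hE : 0 ≤ Real.exp (-(t ^ 2 / 8)) := (Real.exp_pos _).le
    rcases le_total τ 1 with hle | hle
    · refine (hconv _ _ ?_ ?_).trans (mul_le_mul_of_nonneg_right ?_ hE)
      · nlinarith [sq_nonneg t]
      · nlinarith [sq_nonneg t]
      · rw [abs_of_nonpos (by linarith)]; nlinarith [sq_nonneg t]
    · rw [abs_sub_comm]
      refine (hconv _ _ ?_ ?_).trans (mul_le_mul_of_nonneg_right ?_ hE)
      · nlinarith [sq_nonneg t]
      · nlinarith [sq_nonneg t]
      · rw [abs_of_nonneg (by linarith)]; nlinarith [sq_nonneg t]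
  refine (norm_sub_le_norm_sub_add_norm_sub _ (Real.exp (-(τ * t ^ 2 / 2)) : ℂ) _).trans ?_
  linarith

/-- The Gaussian factor makes the frequency integral in Esseen's inequality bounded in `T`. -/
lemma exists_intervalIntegral_gaussian_moment_le : ∃ J : ℝ, 0 < J ∧ ∀ T : ℝ, 0 < T →
    ∫ t in (0 : ℝ)..T, (t ^ 2 + t) * Real.exp (-(t ^ 2 / 8)) ≤ J := by
  have h2 := integrable_rpow_mul_exp_neg_mul_sq (b := 1 / 8) (by norm_num) (s := 2) (by norm_num)
  have h1 := integrable_rpow_mul_exp_neg_mul_sq (b := 1 / 8) (by norm_num) (s := 1) (by norm_num)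
  have hi : Integrable fun t : ℝ => (t ^ 2 + t) * Real.exp (-(t ^ 2 / 8)) := by
    refine (h2.add h1).congr (.of_forall fun t => ?_)
    simp only [Pi.add_apply, Real.rpow_two, Real.rpow_one]
    rw [← add_mul]
    ring_nf
  refine ⟨(∫ t in Set.Ioi (0 : ℝ), (t ^ 2 + t) * Real.exp (-(t ^ 2 / 8))) + 1, ?_, fun T hT => ?_⟩
  · have : 0 ≤ ∫ t in Set.Ioi (0 : ℝ), (t ^ 2 + t) * Real.exp (-(t ^ 2 / 8)) := by
      refine setIntegral_nonneg measurableSet_Ioi fun t ht => ?_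
      have : (0 : ℝ) < t := ht
      positivity
    linarith
  · rw [intervalIntegral.integral_of_le hT.le]
    refine (setIntegral_mono_set hi.integrableOn ?_ Set.Ioc_subset_Ioi_self.eventuallyLE).trans
      (by linarith)
    filter_upwards [ae_restrict_mem measurableSet_Ioi] with t ht
    have : (0 : ℝ) < t := ht
    simp only [Pi.zero_apply]
    positivity

/-- **Berry–Esseen bound for weighted sums** of independent standardised variables. The weights
need not be normalised; the defect of normalisation enters the bound. -/
theorem exists_berryEsseen_weighted {C : ℝ} (hC1 : 1 ≤ C) : ∃ K : ℝ, 0 < K ∧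
    ∀ {ι : Type} [Fintype ι] (μ : ι → Measure ℝ) [∀ i, IsProbabilityMeasure (μ i)]
    (_ : ∀ i, MemLp id 3 (μ i)) (_ : ∀ i, ∫ x, x ∂(μ i) = 0) (_ : ∀ i, ∫ x, x ^ 2 ∂(μ i) = 1)
    (_ : ∀ i, ∫ x, |x| ^ 3 ∂(μ i) ≤ C) (v : ι → ℝ) (t : ℝ),
    |(Measure.pi μ).real {x | ∑ i, x i * v i < t} - (gaussianReal 0 1).real (Set.Iio t)| ≤
      K * ((∑ i, |v i| ^ 3) + |∑ i, v i ^ 2 - 1|) := by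
  obtain ⟨K, hK, hsmooth⟩ := exists_esseen_smoothing
  obtain ⟨J, hJ, hJle⟩ := exists_intervalIntegral_gaussian_moment_le
  refine ⟨64 * (5 * C) + (K * J + 8 * K) * (5 * C), by positivity,
    fun {ι} _ μ _ h3 hx1 hx2 hC v t => ?_⟩
  set s3 := ∑ i, |v i| ^ 3 with hs3
  set d := |∑ i, v i ^ 2 - 1| with hd
  have hs0 : 0 ≤ s3 := Finset.sum_nonneg fun i _ => by positivity
  have hd0 : 0 ≤ d := abs_nonneg _
  set ν := (Measure.pi μ).map fun x => ∑ i, x i * v i with hν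
  have hmeas : Measurable fun x : ι → ℝ => ∑ i, x i * v i := by fun_prop
  have : IsProbabilityMeasure ν := Measure.isProbabilityMeasure_map hmeas.aemeasurable
  have hνt : (Measure.pi μ).real {x | ∑ i, x i * v i < t} = ν.real (Set.Iio t) := by
    rw [hν, map_measureReal_apply hmeas measurableSet_Iio]; rfl
  rw [hνt]
  have hcrude : |ν.real (Set.Iio t) - (gaussianReal 0 1).real (Set.Iio t)| ≤ 1 := by
    have h1 := measureReal_le_one (μ := ν) (s := Set.Iio t)
    have h2 := measureReal_le_one (μ := gaussianReal 0 1) (s := Set.Iio t)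
    have h3 := measureReal_nonneg (μ := ν) (s := Set.Iio t)
    have h4 := measureReal_nonneg (μ := gaussianReal 0 1) (s := Set.Iio t)
    exact abs_le.2 ⟨by linarith, by linarith⟩
  have hKJ : 0 ≤ (K * J + 8 * K) * (5 * C) * (s3 + d) := by positivity
  by_cases hbig : 1 ≤ 64 * (5 * C) * (s3 + d)
  · refine hcrude.trans ?_
    linarith
  -- the remaining case has `L ≤ 1 / 64` and total weight within `1 / 2` of one
  push Not at hbig
  set L := 5 * C * s3 with hL
  have hd2 : d ≤ 1 / 2 := by nlinarith [mul_nonneg (sub_nonneg.2 hC1) hd0, mul_nonneg (sub_nonneg.2 hC1) hs0]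
  have hLsmall : L ≤ 1 / 64 := by nlinarith [mul_nonneg (sub_nonneg.2 hC1) hd0]
  have hLpos : 0 < L := by
    have : s3 ≠ 0 := by
      intro h0
      have hz : ∀ i, v i = 0 := by
        intro i
        have := (Finset.sum_eq_zero_iff_of_nonneg (fun i _ => by positivity)).1 h0 i
          (Finset.mem_univ i)
        simpa using this
      have : d = 1 := by rw [hd]; simp [hz]
      linarith
    have : 0 < s3 := lt_of_le_of_ne hs0 this.symm
    positivity
  have hb := hsmooth ν (gaussianReal 0 1) (fun x y hxy => gaussianReal_real_Iio_sub_le hxy)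
    (1 / (8 * L)) (by positivity) (fun t => (L + d) * ((t ^ 2 + t) * Real.exp (-(t ^ 2 / 8))))
    (Continuous.intervalIntegrable (by fun_prop) _ _) (by
      intro t ht htL
      have htL' : 8 * L * t ≤ 1 := by rw [le_div_iff₀ (by positivity)] at htL; linarith
      have e : charFun (gaussianReal 0 1) t = (Real.exp (-(t ^ 2 / 2)) : ℂ) := by
        rw [charFun_gaussianReal]; push_cast; congr 1; simp
      rw [e, hν, charFun_map_sum_mul]
      refine (norm_prod_charFun_sub_le μ h3 hx1 hx2 hC hC1 v hL rfl hd2 hLsmall ht.le htL').trans ?_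
      have : 0 ≤ Real.exp (-(t ^ 2 / 8)) := (Real.exp_pos _).le
      have e2 : t * ((L + d) * ((t ^ 2 + t) * Real.exp (-(t ^ 2 / 8)))) =
        (L * t ^ 3 + d * t ^ 2) * Real.exp (-(t ^ 2 / 8)) +
          (L * t ^ 2 + d * t ^ 3) * Real.exp (-(t ^ 2 / 8)) := by ring
      rw [e2]
      have : 0 ≤ (L * t ^ 2 + d * t ^ 3) * Real.exp (-(t ^ 2 / 8)) := by positivity
      linarith) t
  refine hb.trans ?_
  have e : (1 : ℝ) / (1 / (8 * L)) = 8 * L := by simp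
  rw [intervalIntegral.integral_const_mul, e]
  have hJ' := mul_le_mul_of_nonneg_left (hJle (1 / (8 * L)) (by positivity)) (by positivity : 0 ≤ L + d)
  have hLd : L + d ≤ 5 * C * (s3 + d) := by nlinarith
  have hL2 : L ≤ 5 * C * (s3 + d) := by linarith
  calc _ ≤ K * ((L + d) * J + 8 * L) := by gcongr
    _ ≤ K * (5 * C * (s3 + d) * J + 8 * (5 * C * (s3 + d))) := by gcongr
    _ = (K * J + 8 * K) * (5 * C) * (s3 + d) := by ring
    _ ≤ _ := by
      have : 0 ≤ 64 * (5 * C) * (s3 + d) := by positivity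
      linarith

/-! ### Conditioning on the weights -/

/-- Berry–Esseen bound for a sum with random weights `V` independent of the summands: Fubini's
theorem reduces it to deterministic weights. -/
theorem exists_berryEsseen_random_weights {C : ℝ} (hC1 : 1 ≤ C) : ∃ K : ℝ, 0 < K ∧
    ∀ {ι : Type} [Fintype ι] (μ : ι → Measure ℝ) [∀ i, IsProbabilityMeasure (μ i)]
    (_ : ∀ i, MemLp id 3 (μ i)) (_ : ∀ i, ∫ x, x ∂(μ i) = 0) (_ : ∀ i, ∫ x, x ^ 2 ∂(μ i) = 1)
    (_ : ∀ i, ∫ x, |x| ^ 3 ∂(μ i) ≤ C) {β : Type} [MeasurableSpace β] (ν : Measure β)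
    [IsProbabilityMeasure ν] (V : β → ι → ℝ) (_ : Measurable V)
    (_ : Integrable (fun w => (∑ i, |V w i| ^ 3) + |∑ i, V w i ^ 2 - 1|) ν) (t : ℝ),
    |((Measure.pi μ).prod ν).real {p | ∑ i, p.1 i * V p.2 i < t} -
      (gaussianReal 0 1).real (Set.Iio t)| ≤
      K * ∫ w, ((∑ i, |V w i| ^ 3) + |∑ i, V w i ^ 2 - 1|) ∂ν := by
  obtain ⟨K, hK, hBE⟩ := exists_berryEsseen_weighted hC1
  refine ⟨K, hK, fun {ι} _ μ _ h3 hx1 hx2 hC {β} _ ν _ V hV hint t => ?_⟩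
  have hs : MeasurableSet {p : (ι → ℝ) × β | ∑ i, p.1 i * V p.2 i < t} :=
    measurableSet_lt (by fun_prop) measurable_const
  have hm := measurable_measure_prodMk_right (μ := Measure.pi μ) hs
  have e : ((Measure.pi μ).prod ν).real {p | ∑ i, p.1 i * V p.2 i < t} =
      ∫ w, (Measure.pi μ).real {x | ∑ i, x i * V w i < t} ∂ν := by
    rw [measureReal_def, Measure.prod_apply_symm hs, ← integral_toReal hm.aemeasurable
      (.of_forall fun w => measure_lt_top _ _)]
    rfl
  have hi : Integrable (fun w => (Measure.pi μ).real {x | ∑ i, x i * V w i < t}) ν := by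
    refine (integrable_const (1 : ℝ)).mono' hm.ennreal_toReal.aestronglyMeasurable
      (.of_forall fun w => ?_)
    rw [Real.norm_of_nonneg measureReal_nonneg]
    exact measureReal_le_one
  have e2 : (gaussianReal 0 1).real (Set.Iio t) =
      ∫ _ : β, (gaussianReal 0 1).real (Set.Iio t) ∂ν := by simp
  rw [e, e2, ← integral_sub hi (integrable_const _), ← integral_const_mul, ← Real.norm_eq_abs]
  exact norm_integral_le_of_norm_le (hint.const_mul K)
    (.of_forall fun w => hBE μ h3 hx1 hx2 hC (V w) t)

/-- Mutual independence of all entries of `X`, `Z` and `S` identifies their joint law, with `S`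
regarded as a family of rows. -/
lemma map_prodMk_eq_prod_pi_of_iIndepFun {Ω α β γ δ : Type*} [MeasurableSpace Ω] [Fintype α]
    [Fintype β] [Fintype γ] [Fintype δ] {P : Measure Ω} [IsProbabilityMeasure P]
    {X : α → Ω → ℝ} {Z : β → Ω → ℝ} {S : γ → δ → Ω → ℝ}
    (hind : iIndepFun (Sum.elim X (Sum.elim Z fun p : γ × δ => S p.1 p.2)) P)
    (hX : ∀ i, AEMeasurable (X i) P) (hZ : ∀ i, AEMeasurable (Z i) P)
    (hS : ∀ k i, AEMeasurable (S k i) P) :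
    P.map (fun ω => ((fun i => X i ω), (fun i => Z i ω), (fun k i => S k i ω))) =
      (Measure.pi fun i => P.map (X i)).prod ((Measure.pi fun i => P.map (Z i)).prod
        (Measure.pi fun k => Measure.pi fun i => P.map (S k i))) := by
  have hW : ∀ j, AEMeasurable (Sum.elim X (Sum.elim Z fun p : γ × δ => S p.1 p.2) j) P := by
    rintro (i | i | p)
    exacts [hX i, hZ i, hS p.1 p.2]
  have : ∀ i, IsProbabilityMeasure (P.map (X i)) := fun i => Measure.isProbabilityMeasure_map (hX i)
  have : ∀ i, IsProbabilityMeasure (P.map (Z i)) := fun i => Measure.isProbabilityMeasure_map (hZ i)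
  have : ∀ k i, IsProbabilityMeasure (P.map (S k i)) := fun k i =>
    Measure.isProbabilityMeasure_map (hS k i)
  set ρ := (Measure.pi fun i => P.map (X i)).prod ((Measure.pi fun i => P.map (Z i)).prod
        (Measure.pi fun k => Measure.pi fun i => P.map (S k i))) with hρ
  let T : (α ⊕ β ⊕ γ × δ → ℝ) → (α → ℝ) × (β → ℝ) × (γ → δ → ℝ) := fun w =>
    (fun i => w (.inl i), fun i => w (.inr (.inl i)), fun k i => w (.inr (.inr (k, i))))
  let U : (α → ℝ) × (β → ℝ) × (γ → δ → ℝ) → (α ⊕ β ⊕ γ × δ → ℝ) := fun q =>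
    Sum.elim q.1 (Sum.elim q.2.1 fun p => q.2.2 p.1 p.2)
  have hT : Measurable T := by fun_prop
  have hU : Measurable U := by
    rw [measurable_pi_iff]
    rintro (i | i | p) <;> simp only [U, Sum.elim_inl, Sum.elim_inr] <;> fun_prop
  have hpi := hind.map_fun_eq_pi_map hW
  have hρU : Measure.pi (fun j => P.map (Sum.elim X (Sum.elim Z fun p : γ × δ => S p.1 p.2) j)) =
      ρ.map U := by
    have : ∀ j, IsProbabilityMeasure (P.map (Sum.elim X (Sum.elim Z fun p : γ × δ => S p.1 p.2) j)) :=
      fun j => Measure.isProbabilityMeasure_map (hW j)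
    -- both sides agree on boxes
    refine Measure.pi_eq fun s hs => ?_
    rw [Measure.map_apply hU (.univ_pi hs)]
    have : U ⁻¹' (Set.univ.pi s) = (Set.univ.pi fun i => s (.inl i)) ×ˢ
        ((Set.univ.pi fun i => s (.inr (.inl i))) ×ˢ
          (Set.univ.pi fun k => Set.univ.pi fun i => s (.inr (.inr (k, i))))) := by
      ext q
      simp [U, Set.mem_pi, Sum.forall]
    rw [this, hρ, Measure.prod_prod, Measure.prod_prod, Measure.pi_pi, Measure.pi_pi, Measure.pi_pi]
    simp_rw [Measure.pi_pi]
    simp [Fintype.prod_sum_type, Fintype.prod_prod_type]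
  have hTU : ρ.map (T ∘ U) = ρ := by
    have : T ∘ U = id := rfl
    rw [this, Measure.map_id]
  rw [← hTU, ← Measure.map_map hT hU, ← hρU, ← hpi,
    AEMeasurable.map_map_of_aemeasurable hT.aemeasurable (aemeasurable_pi_lambda _ hW)]
  rfl

/-! ### Moments of sums of independent variables -/

section Moments
variable {Ω : Type*} [MeasurableSpace Ω] {P : Measure Ω}

lemma integral_sum_eq_zero {ι : Type*} {W : ι → Ω → ℝ} (hW : ∀ i, Integrable (W i) P) (hW0 : ∀ i, ∫ ω, W i ω ∂P = 0)
    (s : Finset ι) : ∫ ω, (∑ i ∈ s, W i ω) ∂P = 0 := by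
  rw [integral_finsetSum _ fun i _ => hW i]
  exact Finset.sum_eq_zero fun i _ => hW0 i

lemma indepFun_sum_of_notMem {ι E : Type*} [AddCommMonoid E] [MeasurableSpace E] [MeasurableAdd₂ E]
    {W : ι → Ω → E} (hind : iIndepFun W P) (hm : ∀ i, AEMeasurable (W i) P) {s : Finset ι} {i : ι}
    (hi : i ∉ s) : IndepFun (fun ω => ∑ j ∈ s, W j ω) (W i) P := by
  have h := hind.indepFun_finsetSum_of_notMem₀ hm hi
  have e : (∑ j ∈ s, W j) = fun ω => ∑ j ∈ s, W j ω := by ext1 ω; exact Finset.sum_apply ω s W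
  rwa [e] at h

lemma integral_sq_add_of_indepFun {R W : Ω → ℝ} (h : IndepFun R W P) (hR : MemLp R 2 P)
    (hW : MemLp W 2 P) (hW0 : ∫ ω, W ω ∂P = 0) :
    ∫ ω, (R ω + W ω) ^ 2 ∂P = ∫ ω, R ω ^ 2 ∂P + ∫ ω, W ω ^ 2 ∂P := by
  have e : ∀ ω, (R ω + W ω) ^ 2 = R ω ^ 2 + (2 * (R ω * W ω) + W ω ^ 2) := fun ω => by ring
  have h2 : Integrable (fun ω => 2 * (R ω * W ω)) P := (hR.integrable_mul hW).const_mul 2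
  simp_rw [e]
  have h3 : Integrable (fun ω => 2 * (R ω * W ω) + W ω ^ 2) P := h2.add hW.integrable_sq
  rw [integral_add hR.integrable_sq h3, integral_add h2 hW.integrable_sq,
    integral_const_mul, h.integral_fun_mul_eq_mul_integral hR.1 hW.1, hW0]
  ring

lemma integral_sq_sum_of_iIndepFun {ι : Type*} {W : ι → Ω → ℝ} (hind : iIndepFun W P) (hW : ∀ i, MemLp (W i) 2 P)
    (hW0 : ∀ i, ∫ ω, W i ω ∂P = 0) (s : Finset ι) :
    ∫ ω, (∑ i ∈ s, W i ω) ^ 2 ∂P = ∑ i ∈ s, ∫ ω, W i ω ^ 2 ∂P := by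
  classical
  induction s using Finset.induction_on with
  | empty => simp
  | insert i s hi ih =>
    simp_rw [Finset.sum_insert hi]
    rw [← ih, add_comm (∫ ω, W i ω ^ 2 ∂P)]
    simp_rw [add_comm (W i _)]
    exact integral_sq_add_of_indepFun
      (indepFun_sum_of_notMem hind (fun j => (hW j).1.aemeasurable) hi)
      (memLp_finsetSum s fun j _ => hW j) (hW i) (hW0 i)

variable [IsProbabilityMeasure P]

lemma integrable_pow_of_memLp {f : Ω → ℝ} {p k : ℕ} (hf : MemLp f p P) (hk : k ≤ p) :
    Integrable (fun ω => f ω ^ k) P := by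
  have h : MemLp f k P := hf.mono_exponent (by exact_mod_cast hk)
  have h2 : Integrable (fun ω => ‖f ω‖ ^ k) P := h.integrable_norm_pow'
  refine (integrable_norm_iff ?_).1 (h2.congr (.of_forall fun ω => (norm_pow _ _).symm))
  exact hf.1.pow k

lemma memLp_sq_of_memLp_four {f : Ω → ℝ} (hf : MemLp f 4 P) : MemLp (fun ω => f ω ^ 2) 2 P := by
  have hm : AEStronglyMeasurable (fun ω => f ω ^ 2) P := hf.1.pow 2
  rw [memLp_two_iff_integrable_sq hm]
  exact (integrable_pow_of_memLp (p := 4) (k := 4) (by exact_mod_cast hf) le_rfl).congr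
    (.of_forall fun ω => by ring)

lemma sq_integral_le_integral_sq {f : Ω → ℝ} (hf : MemLp f 2 P) :
    (∫ ω, f ω ∂P) ^ 2 ≤ ∫ ω, f ω ^ 2 ∂P := by
  have h := variance_eq_sub hf
  have h2 := variance_nonneg f P
  simp only [Pi.pow_apply] at h
  linarith

lemma integral_pow_four_add_of_indepFun {R W : Ω → ℝ} (h : IndepFun R W P) (hR : MemLp R 4 P)
    (hW : MemLp W 4 P) (hR0 : ∫ ω, R ω ∂P = 0) (hW0 : ∫ ω, W ω ∂P = 0) :
    ∫ ω, (R ω + W ω) ^ 4 ∂P =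
      ∫ ω, R ω ^ 4 ∂P + 6 * ((∫ ω, R ω ^ 2 ∂P) * ∫ ω, W ω ^ 2 ∂P) + ∫ ω, W ω ^ 4 ∂P := by
  have hRi : ∀ k ≤ 4, Integrable (fun ω => R ω ^ k) P := fun k hk =>
    integrable_pow_of_memLp (p := 4) (by exact_mod_cast hR) hk
  have hWi : ∀ k ≤ 4, Integrable (fun ω => W ω ^ k) P := fun k hk =>
    integrable_pow_of_memLp (p := 4) (by exact_mod_cast hW) hk
  have hind : ∀ j k : ℕ, IndepFun (fun ω => R ω ^ j) (fun ω => W ω ^ k) P := fun j k =>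
    h.comp (φ := fun x : ℝ => x ^ j) (ψ := fun x : ℝ => x ^ k) (by fun_prop) (by fun_prop)
  have hint : ∀ j k : ℕ, j ≤ 4 → k ≤ 4 → ∀ c : ℝ, Integrable (fun ω => c * (R ω ^ j * W ω ^ k)) P :=
    fun j k hj hk c => ((hind j k).integrable_mul (hRi j hj) (hWi k hk)).const_mul c
  have hval : ∀ j k : ℕ, j ≤ 4 → k ≤ 4 → ∀ c : ℝ, ∫ ω, c * (R ω ^ j * W ω ^ k) ∂P =
      c * ((∫ ω, R ω ^ j ∂P) * ∫ ω, W ω ^ k ∂P) := fun j k hj hk c => by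
    rw [integral_const_mul, (hind j k).integral_fun_mul_eq_mul_integral (hRi j hj).1 (hWi k hk).1]
  have e : ∀ ω, (R ω + W ω) ^ 4 = 1 * (R ω ^ 4 * W ω ^ 0) + (4 * (R ω ^ 3 * W ω ^ 1) +
      (6 * (R ω ^ 2 * W ω ^ 2) + (4 * (R ω ^ 1 * W ω ^ 3) + 1 * (R ω ^ 0 * W ω ^ 4)))) :=
    fun ω => by ring
  have i0 := hint 4 0 (by norm_num) (by norm_num) 1
  have i1 := hint 3 1 (by norm_num) (by norm_num) 4
  have i2 := hint 2 2 (by norm_num) (by norm_num) 6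
  have i3 := hint 1 3 (by norm_num) (by norm_num) 4
  have i4 := hint 0 4 (by norm_num) (by norm_num) 1
  have j3 : Integrable (fun ω => 4 * (R ω ^ 1 * W ω ^ 3) + 1 * (R ω ^ 0 * W ω ^ 4)) P := i3.add i4
  have j2 : Integrable (fun ω => 6 * (R ω ^ 2 * W ω ^ 2) +
      (4 * (R ω ^ 1 * W ω ^ 3) + 1 * (R ω ^ 0 * W ω ^ 4))) P := i2.add j3
  have j1 : Integrable (fun ω => 4 * (R ω ^ 3 * W ω ^ 1) + (6 * (R ω ^ 2 * W ω ^ 2) +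
      (4 * (R ω ^ 1 * W ω ^ 3) + 1 * (R ω ^ 0 * W ω ^ 4)))) P := i1.add j2
  simp_rw [e]
  rw [integral_add i0 j1, integral_add i1 j2, integral_add i2 j3, integral_add i3 i4,
    hval _ _ (by norm_num) (by norm_num), hval _ _ (by norm_num) (by norm_num),
    hval _ _ (by norm_num) (by norm_num), hval _ _ (by norm_num) (by norm_num),
    hval _ _ (by norm_num) (by norm_num)]
  simp [hR0, hW0]
  ring

variable {ι : Type*} {W : ι → Ω → ℝ}

/-- Fourth moments of sums of independent centred variables grow like the square of the sum of the
scales, as in the Khintchine inequality. -/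
lemma integral_pow_four_sum_le (hind : iIndepFun W P) (hW : ∀ i, MemLp (W i) 4 P)
    (hW0 : ∀ i, ∫ ω, W i ω ∂P = 0) {c : ι → ℝ} (hc : ∀ i, 0 ≤ c i)
    (hWc : ∀ i, ∫ ω, W i ω ^ 4 ∂P ≤ c i ^ 2) (s : Finset ι) :
    ∫ ω, (∑ i ∈ s, W i ω) ^ 4 ∂P ≤ 3 * (∑ i ∈ s, c i) ^ 2 := by
  classical
  have hW2 : ∀ i, MemLp (W i) 2 P := fun i => (hW i).mono_exponent (by norm_num)
  have hsq : ∀ i, ∫ ω, W i ω ^ 2 ∂P ≤ c i := by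
    intro i
    have h := sq_integral_le_integral_sq (memLp_sq_of_memLp_four (hW i))
    have e : ∫ ω, (W i ω ^ 2) ^ 2 ∂P = ∫ ω, W i ω ^ 4 ∂P := by congr 1; ext ω; ring
    rw [e] at h
    exact le_of_sq_le_sq (h.trans (hWc i)) (hc i)
  induction s using Finset.induction_on with
  | empty => simp
  | insert i s hi ih =>
    simp_rw [Finset.sum_insert hi, add_comm (W i _), add_comm (c i)]
    rw [integral_pow_four_add_of_indepFun
      (indepFun_sum_of_notMem hind (fun j => (hW j).1.aemeasurable) hi)
      (memLp_finsetSum s fun j _ => hW j) (hW i)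
      (integral_sum_eq_zero (fun j => (hW j).integrable (by norm_num)) hW0 s) (hW0 i),
      integral_sq_sum_of_iIndepFun hind hW2 hW0]
    have h1 : ∑ j ∈ s, ∫ ω, W j ω ^ 2 ∂P ≤ ∑ j ∈ s, c j := Finset.sum_le_sum fun j _ => hsq j
    have h2 : 0 ≤ ∫ ω, W i ω ^ 2 ∂P := integral_nonneg fun ω => sq_nonneg _
    have h3 : (∑ j ∈ s, ∫ ω, W j ω ^ 2 ∂P) * ∫ ω, W i ω ^ 2 ∂P ≤ (∑ j ∈ s, c j) * c i :=
      mul_le_mul h1 (hsq i) h2 (Finset.sum_nonneg fun j _ => hc j)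
    nlinarith [hWc i, sq_nonneg (c i)]

end Moments

/-! ### Squared norms of sums of independent random vectors -/

section Vectors
open scoped RealInnerProductSpace
variable {Ω : Type*} [MeasurableSpace Ω] {P : Measure Ω} {E : Type*} [NormedAddCommGroup E]
  {R η : Ω → E}

lemma integrable_norm_pow_four (hR : MemLp R 4 P) : Integrable (fun ω => ‖R ω‖ ^ 4) P :=
  hR.integrable_norm_pow (p := 4) (by norm_num)

variable [IsProbabilityMeasure P]

lemma memLp_norm_sq (hR : MemLp R 4 P) : MemLp (fun ω => ‖R ω‖ ^ 2) 2 P :=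
  memLp_sq_of_memLp_four hR.norm

lemma integral_inner_eq_zero [InnerProductSpace ℝ E] [CompleteSpace E] (hη : MemLp η 4 P) (hη0 : ∫ ω, η ω ∂P = 0) (u : E) :
    ∫ ω, ⟪u, η ω⟫ ∂P = 0 := by
  rw [integral_inner (hη.integrable (by norm_num)), hη0, inner_zero_right]

lemma memLp_inner [InnerProductSpace ℝ E] (hR : MemLp R 4 P) (hη : MemLp η 4 P) : MemLp (fun ω => ⟪R ω, η ω⟫) 2 P := by
  refine ((memLp_norm_sq hR).add (memLp_norm_sq hη)).mono' (hR.1.inner hη.1) (.of_forall fun ω => ?_)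
  refine (norm_inner_le_norm _ _).trans ?_
  simp only [Pi.add_apply]
  nlinarith [sq_nonneg (‖R ω‖ - ‖η ω‖), sq_nonneg (‖R ω‖), sq_nonneg ‖η ω‖]

variable [MeasurableSpace E] [BorelSpace E] [SecondCountableTopology E]

/-- Fubini's theorem for a function of two independent variables. -/
lemma integral_comp_prodMk_of_indepFun (h : IndepFun R η P) (hR : AEMeasurable R P)
    (hη : AEMeasurable η P) {F : E × E → ℝ} (hF : Continuous F)
    (hint : Integrable (fun ω => F (R ω, η ω)) P) :
    ∫ ω, F (R ω, η ω) ∂P = ∫ ω, ∫ ω', F (R ω, η ω') ∂P ∂P := by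
  have hmap := h.map_prod_eq_prod_map_map hR hη
  have hRη : AEMeasurable (fun ω => (R ω, η ω)) P := hR.prodMk hη
  have : IsProbabilityMeasure (P.map R) := Measure.isProbabilityMeasure_map hR
  have : IsProbabilityMeasure (P.map η) := Measure.isProbabilityMeasure_map hη
  have hi : Integrable F ((P.map R).prod (P.map η)) := by
    rw [← hmap]
    exact (integrable_map_measure hF.aestronglyMeasurable hRη).2 hint
  rw [← integral_map hRη hF.aestronglyMeasurable, hmap, integral_prod _ hi, integral_map hR]
  · congr 1
    ext ω
    exact integral_map hη (hF.comp (by fun_prop)).aestronglyMeasurable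
  · exact hi.integral_prod_left.1

variable [InnerProductSpace ℝ E]

/-- One step of the martingale `‖η₁ + ⋯ + ηₘ‖² - m τ`: the increment is orthogonal to the past,
and its second moment is controlled by the covariance bound `b`. -/
lemma integral_norm_sq_add_sub_sq_le [CompleteSpace E] (h : IndepFun R η P) (hR : MemLp R 4 P)
    (hη : MemLp η 4 P) (hη0 : ∫ ω, η ω ∂P = 0) {a b τ c : ℝ} (hτ : ∫ ω, ‖η ω‖ ^ 2 ∂P = τ)
    (ha : ∫ ω, ‖η ω‖ ^ 4 ∂P ≤ a) (hb : ∀ u : E, ∫ ω, ⟪u, η ω⟫ ^ 2 ∂P ≤ b * ‖u‖ ^ 2)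
    (hc : ∫ ω, ‖R ω‖ ^ 2 ∂P = c) :
    ∫ ω, ‖R ω + η ω‖ ^ 2 ∂P = c + τ ∧
    ∫ ω, (‖R ω + η ω‖ ^ 2 - (c + τ)) ^ 2 ∂P ≤
      ∫ ω, (‖R ω‖ ^ 2 - c) ^ 2 ∂P + 8 * b * c + 2 * a := by
  have hRm := hR.1.aemeasurable
  have hηm := hη.1.aemeasurable
  have hin := memLp_inner hR hη
  have hR2 := memLp_norm_sq hR
  have hη2 := memLp_norm_sq hη
  have hM : MemLp (fun ω => ‖R ω‖ ^ 2 - c) 2 P := hR2.sub (memLp_const c)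
  have hN : MemLp (fun ω => ‖η ω‖ ^ 2 - τ) 2 P := hη2.sub (memLp_const τ)
  have hcross : ∫ ω, ⟪R ω, η ω⟫ ∂P = 0 := by
    rw [integral_comp_prodMk_of_indepFun h hRm hηm (F := fun p => ⟪p.1, p.2⟫) (by fun_prop)
      (hin.integrable (by norm_num))]
    simp_rw [integral_inner_eq_zero hη hη0]
    simp
  have hMcross : ∫ ω, (‖R ω‖ ^ 2 - c) * ⟪R ω, η ω⟫ ∂P = 0 := by
    rw [integral_comp_prodMk_of_indepFun h hRm hηm (F := fun p => (‖p.1‖ ^ 2 - c) * ⟪p.1, p.2⟫)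
      (by fun_prop) (hM.integrable_mul hin)]
    simp_rw [integral_const_mul, integral_inner_eq_zero hη hη0]
    simp
  have hMN : ∫ ω, (‖R ω‖ ^ 2 - c) * (‖η ω‖ ^ 2 - τ) ∂P = 0 := by
    have hi : IndepFun (fun ω => ‖R ω‖ ^ 2 - c) (fun ω => ‖η ω‖ ^ 2 - τ) P :=
      h.comp (φ := fun x : E => ‖x‖ ^ 2 - c) (ψ := fun x : E => ‖x‖ ^ 2 - τ) (by fun_prop)
        (by fun_prop)
    rw [hi.integral_fun_mul_eq_mul_integral hM.1 hN.1,
      integral_sub (hη2.integrable (by norm_num)) (integrable_const τ), hτ]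
    simp
  have hin2 : ∫ ω, ⟪R ω, η ω⟫ ^ 2 ∂P ≤ b * c := by
    rw [integral_comp_prodMk_of_indepFun h hRm hηm (F := fun p => ⟪p.1, p.2⟫ ^ 2) (by fun_prop)
      hin.integrable_sq, ← hc, ← integral_const_mul]
    refine integral_mono_of_nonneg (.of_forall fun ω => integral_nonneg fun ω' => sq_nonneg _)
      ((hR2.integrable (by norm_num)).const_mul b) (.of_forall fun ω => hb _)
  have hN2 : ∫ ω, (‖η ω‖ ^ 2 - τ) ^ 2 ∂P ≤ a := by
    have e : ∀ ω, (‖η ω‖ ^ 2 - τ) ^ 2 = ‖η ω‖ ^ 4 - (2 * τ * ‖η ω‖ ^ 2 - τ ^ 2) := fun ω => by ring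
    have i1 : Integrable (fun ω => 2 * τ * ‖η ω‖ ^ 2) P :=
      (hη2.integrable (by norm_num)).const_mul _
    have i2 : Integrable (fun ω => 2 * τ * ‖η ω‖ ^ 2 - τ ^ 2) P := i1.sub (integrable_const _)
    simp_rw [e]
    rw [integral_sub (integrable_norm_pow_four hη) i2,
      integral_sub i1 (integrable_const _), integral_const_mul, hτ]
    simp only [integral_const, probReal_univ, one_smul]
    nlinarith [sq_nonneg τ]
  have hexp : ∀ ω, ‖R ω + η ω‖ ^ 2 = ‖R ω‖ ^ 2 + (2 * ⟪R ω, η ω⟫ + ‖η ω‖ ^ 2) := fun ω => by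
    rw [norm_add_sq_real]; ring
  constructor
  · have i1 : Integrable (fun ω => 2 * ⟪R ω, η ω⟫) P := (hin.integrable (by norm_num)).const_mul 2
    have i2 : Integrable (fun ω => ‖η ω‖ ^ 2) P := hη2.integrable (by norm_num)
    have i3 : Integrable (fun ω => 2 * ⟪R ω, η ω⟫ + ‖η ω‖ ^ 2) P := i1.add i2
    simp_rw [hexp]
    rw [integral_add (hR2.integrable (by norm_num)) i3, integral_add i1 i2,
      integral_const_mul, hcross, hc, hτ]
    ring
  · have i0 : Integrable (fun ω => (‖R ω‖ ^ 2 - c) ^ 2) P := hM.integrable_sq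
    have i1 : Integrable (fun ω => 4 * ((‖R ω‖ ^ 2 - c) * ⟪R ω, η ω⟫)) P :=
      (hM.integrable_mul hin).const_mul 4
    have i2 : Integrable (fun ω => 2 * ((‖R ω‖ ^ 2 - c) * (‖η ω‖ ^ 2 - τ))) P :=
      (hM.integrable_mul hN).const_mul 2
    have i3 : Integrable (fun ω => 8 * ⟪R ω, η ω⟫ ^ 2) P := hin.integrable_sq.const_mul 8
    have i4 : Integrable (fun ω => 2 * (‖η ω‖ ^ 2 - τ) ^ 2) P := hN.integrable_sq.const_mul 2
    have hle : ∫ ω, (‖R ω + η ω‖ ^ 2 - (c + τ)) ^ 2 ∂P ≤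
        ∫ ω, ((‖R ω‖ ^ 2 - c) ^ 2 + (4 * ((‖R ω‖ ^ 2 - c) * ⟪R ω, η ω⟫) +
          (2 * ((‖R ω‖ ^ 2 - c) * (‖η ω‖ ^ 2 - τ)) + (8 * ⟪R ω, η ω⟫ ^ 2 +
            2 * (‖η ω‖ ^ 2 - τ) ^ 2)))) ∂P := by
      refine integral_mono_of_nonneg (.of_forall fun ω => sq_nonneg _)
        (i0.add (i1.add (i2.add (i3.add i4)))) (.of_forall fun ω => ?_)
      simp only [hexp]
      nlinarith [sq_nonneg (2 * ⟪R ω, η ω⟫ - (‖η ω‖ ^ 2 - τ))]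
    have j3 : Integrable (fun ω => 8 * ⟪R ω, η ω⟫ ^ 2 + 2 * (‖η ω‖ ^ 2 - τ) ^ 2) P := i3.add i4
    have j2 : Integrable (fun ω => 2 * ((‖R ω‖ ^ 2 - c) * (‖η ω‖ ^ 2 - τ)) +
      (8 * ⟪R ω, η ω⟫ ^ 2 + 2 * (‖η ω‖ ^ 2 - τ) ^ 2)) P := i2.add j3
    have j1 : Integrable (fun ω => 4 * ((‖R ω‖ ^ 2 - c) * ⟪R ω, η ω⟫) +
          (2 * ((‖R ω‖ ^ 2 - c) * (‖η ω‖ ^ 2 - τ)) + (8 * ⟪R ω, η ω⟫ ^ 2 +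
            2 * (‖η ω‖ ^ 2 - τ) ^ 2))) P := i1.add j2
    rw [integral_add i0 j1, integral_add i1 j2, integral_add i2 j3, integral_add i3 i4,
      integral_const_mul, integral_const_mul, integral_const_mul, integral_const_mul, hMcross,
      hMN] at hle
    linarith

/-- Concentration of the squared norm of a sum of independent centred random vectors. -/
lemma integral_norm_sq_sum_sub_sq_le [CompleteSpace E] {ι : Type*} {η : ι → Ω → E}
    (hind : iIndepFun η P) (hη : ∀ k, MemLp (η k) 4 P) (hη0 : ∀ k, ∫ ω, η k ω ∂P = 0) {a b τ : ℝ}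
    (hτ : ∀ k, ∫ ω, ‖η k ω‖ ^ 2 ∂P = τ) (ha : ∀ k, ∫ ω, ‖η k ω‖ ^ 4 ∂P ≤ a) (hb0 : 0 ≤ b)
    (hb : ∀ k (u : E), ∫ ω, ⟪u, η k ω⟫ ^ 2 ∂P ≤ b * ‖u‖ ^ 2) (s : Finset ι) :
    ∫ ω, ‖∑ k ∈ s, η k ω‖ ^ 2 ∂P = s.card * τ ∧
    ∫ ω, (‖∑ k ∈ s, η k ω‖ ^ 2 - s.card * τ) ^ 2 ∂P ≤
      8 * b * τ * (s.card : ℝ) ^ 2 + 2 * a * s.card := by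
  classical
  induction s using Finset.induction_on with
  | empty => simp
  | insert k s hk ih =>
    have hτ0 : 0 ≤ τ := by rw [← hτ k]; exact integral_nonneg fun ω => sq_nonneg _
    have hstep := integral_norm_sq_add_sub_sq_le
      (indepFun_sum_of_notMem hind (fun j => (hη j).1.aemeasurable) hk)
      (memLp_finsetSum s fun j _ => hη j) (hη k) (hη0 k) (hτ k) (ha k) (hb k) ih.1
    have e : ((insert k s).card : ℝ) = s.card + 1 := by
      rw [Finset.card_insert_of_notMem hk]; push_cast; ring
    have e2 : ((s.card : ℝ) + 1) * τ = s.card * τ + τ := by ring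
    simp_rw [Finset.sum_insert hk, add_comm (η k _), e, e2]
    refine ⟨hstep.1, hstep.2.trans ?_⟩
    have h1 : 0 ≤ 8 * b * τ * ((s.card : ℝ) + 1) := by positivity
    nlinarith [ih.2]

end Vectors

/-! ### One row of the random matrix -/

lemma mul_sum_eq_add_erase {Ω ι : Type*} [Fintype ι] [DecidableEq ι] {s : ι → Ω → ℝ} (i : ι) (z : ι → ℝ) (ω : Ω) : s i ω * ∑ j, s j ω * z j =
    s i ω ^ 2 * z i + s i ω * ∑ j ∈ Finset.univ.erase i, s j ω * z j := by
  rw [← Finset.add_sum_erase Finset.univ _ (Finset.mem_univ i)]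
  ring

lemma add_pow_four_le (a b : ℝ) : (a + b) ^ 4 ≤ 8 * (a ^ 4 + b ^ 4) := by
  have := (show Even 4 by decide).add_pow_le (a := a) (b := b)
  norm_num at this
  exact this

section Row
variable {Ω : Type*} [MeasurableSpace Ω] {P : Measure Ω} {ι : Type*}

/-- A row of independent standardised variables with common fourth moment `κ` and eighth moment at
most `C`. -/
structure IsStandardRow (s : ι → Ω → ℝ) (P : Measure Ω) (C κ : ℝ) : Prop where
  indep : iIndepFun s P
  memLp : ∀ i, MemLp (s i) 8 P
  mean : ∀ i, ∫ ω, s i ω ∂P = 0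
  second : ∀ i, ∫ ω, s i ω ^ 2 ∂P = 1
  fourth : ∀ i, ∫ ω, s i ω ^ 4 ∂P = κ
  eighth : ∀ i, ∫ ω, s i ω ^ 8 ∂P ≤ C

variable {s : ι → Ω → ℝ} {C κ : ℝ}

lemma memLp_four_mul {f g : Ω → ℝ} (hf : MemLp f 8 P) (hg : MemLp g 8 P) :
    MemLp (fun ω => f ω * g ω) 4 P := by
  have : ENNReal.HolderTriple 8 8 4 := ⟨by
    rw [show (8 : ENNReal) = 4 * 2 by norm_num,
      ENNReal.mul_inv (by norm_num) (by norm_num), ← mul_add, ENNReal.inv_two_add_inv_two, mul_one]⟩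
  exact hg.mul hf

namespace IsStandardRow

lemma kurtosis_nonneg (h : IsStandardRow s P C κ) (i : ι) : 0 ≤ κ := by
  rw [← h.fourth i]
  exact integral_nonneg fun ω => by positivity

lemma indep_mul (h : IsStandardRow s P C κ) (u : ι → ℝ) : iIndepFun (fun j ω => s j ω * u j) P :=
  h.indep.comp (fun j x => x * u j) fun j => by fun_prop

lemma memLp_sum (h : IsStandardRow s P C κ) (t : Finset ι) (u : ι → ℝ) :
    MemLp (fun ω => ∑ j ∈ t, s j ω * u j) 8 P :=
  memLp_finsetSum t fun j _ => (h.memLp j).mul_const (u j)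

lemma indepFun_sum (h : IsStandardRow s P C κ) {t : Finset ι} {i : ι} (hi : i ∉ t) (u : ι → ℝ) :
    IndepFun (s i) (fun ω => ∑ j ∈ t, s j ω * u j) P := by
  classical
  -- give the `i`-th entry weight one, which does not change the sum over `t`
  have h1 := indepFun_sum_of_notMem (h.indep_mul (Function.update u i 1))
    (fun j => ((h.memLp j).mul_const _).1.aemeasurable) hi
  have e1 : (fun ω => s i ω * Function.update u i 1 i) = s i := by ext ω; simp
  have e2 : (fun ω => ∑ j ∈ t, s j ω * Function.update u i 1 j) =
      fun ω => ∑ j ∈ t, s j ω * u j := by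
    ext ω
    refine Finset.sum_congr rfl fun j hj => ?_
    rw [Function.update_of_ne (ne_of_mem_of_not_mem hj hi)]
  rw [e1, e2] at h1
  exact h1.symm

lemma memLp_mul_sum [Fintype ι] (h : IsStandardRow s P C κ) (i : ι) (z : ι → ℝ) :
    MemLp (fun ω => s i ω * ∑ j, s j ω * z j) 4 P :=
  memLp_four_mul (h.memLp i) (h.memLp_sum Finset.univ z)

variable [IsProbabilityMeasure P]

lemma memLp_four (h : IsStandardRow s P C κ) (i : ι) : MemLp (s i) 4 P :=
  (h.memLp i).mono_exponent (by norm_num)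

lemma kurtosis_le (h : IsStandardRow s P C κ) (hC : 1 ≤ C) (i : ι) : κ ≤ C := by
  have i8 : Integrable (fun ω => s i ω ^ 8) P :=
    integrable_pow_of_memLp (p := 8) (by exact_mod_cast h.memLp i) le_rfl
  have i4 : Integrable (fun ω => 2 * s i ω ^ 4) P :=
    (integrable_pow_of_memLp (p := 8) (by exact_mod_cast h.memLp i) (by norm_num)).const_mul 2
  have hle : ∫ ω, 2 * s i ω ^ 4 ∂P ≤ ∫ ω, (s i ω ^ 8 + 1) ∂P :=
    integral_mono i4 (i8.add (integrable_const 1)) fun ω => by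
      simp only
      nlinarith [sq_nonneg (s i ω ^ 4 - 1)]
  rw [integral_const_mul, h.fourth, integral_add i8 (integrable_const 1)] at hle
  have := h.eighth i
  simp at hle
  linarith

lemma integral_sum (h : IsStandardRow s P C κ) (t : Finset ι) (u : ι → ℝ) :
    ∫ ω, (∑ j ∈ t, s j ω * u j) ∂P = 0 :=
  integral_sum_eq_zero (W := fun j ω => s j ω * u j)
    (fun j => ((h.memLp j).mul_const (u j)).integrable (by norm_num))
    (fun j => by rw [integral_mul_const, h.mean, zero_mul]) t

lemma integral_sum_sq (h : IsStandardRow s P C κ) (t : Finset ι) (u : ι → ℝ) :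
    ∫ ω, (∑ j ∈ t, s j ω * u j) ^ 2 ∂P = ∑ j ∈ t, u j ^ 2 := by
  rw [integral_sq_sum_of_iIndepFun (h.indep_mul u)
    (fun j => ((h.memLp j).mul_const (u j)).mono_exponent (by norm_num))
    (fun j => by rw [integral_mul_const, h.mean, zero_mul])]
  simp_rw [mul_pow, integral_mul_const, h.second, one_mul]

lemma integral_sum_pow_four_le (h : IsStandardRow s P C κ) (hC : 1 ≤ C) (t : Finset ι)
    (u : ι → ℝ) : ∫ ω, (∑ j ∈ t, s j ω * u j) ^ 4 ∂P ≤ 3 * C * (∑ j ∈ t, u j ^ 2) ^ 2 := by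
  have hC0 : 0 ≤ C := by linarith
  have := integral_pow_four_sum_le (h.indep_mul u) (fun j => (h.memLp_four j).mul_const (u j))
    (fun j => by rw [integral_mul_const, h.mean, zero_mul]) (c := fun j => √C * u j ^ 2)
    (fun j => by positivity) (fun j => by
      simp_rw [mul_pow]
      rw [integral_mul_const, h.fourth, Real.sq_sqrt hC0, ← pow_mul]
      exact mul_le_mul_of_nonneg_right (h.kurtosis_le hC j) (by positivity)) t
  rw [← Finset.mul_sum, mul_pow, Real.sq_sqrt hC0] at this
  linarith

variable [Fintype ι]

lemma integral_mul_sum (h : IsStandardRow s P C κ) (i : ι) (z : ι → ℝ) :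
    ∫ ω, s i ω * ∑ j, s j ω * z j ∂P = z i := by
  classical
  have hY := h.memLp_sum (Finset.univ.erase i) z
  have hsq : Integrable (fun ω => s i ω ^ 2 * z i) P :=
    (((h.memLp_four i).mono_exponent (by norm_num)).integrable_sq).mul_const _
  have hp : Integrable (fun ω => s i ω * ∑ j ∈ Finset.univ.erase i, s j ω * z j) P :=
    (memLp_four_mul (h.memLp i) hY).integrable (by norm_num)
  simp_rw [mul_sum_eq_add_erase]
  rw [integral_add hsq hp, integral_mul_const, h.second,
    (h.indepFun_sum (Finset.notMem_erase i _) z).integral_fun_mul_eq_mul_integral (h.memLp i).1 hY.1,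
    h.mean]
  ring

lemma integral_mul_sum_sq (h : IsStandardRow s P C κ) (i : ι) (z : ι → ℝ) :
    ∫ ω, (s i ω * ∑ j, s j ω * z j) ^ 2 ∂P = (κ - 1) * z i ^ 2 + ∑ j, z j ^ 2 := by
  classical
  have hY := h.memLp_sum (Finset.univ.erase i) z
  have hind := h.indepFun_sum (Finset.notMem_erase i Finset.univ) z
  set Y := fun ω => ∑ j ∈ Finset.univ.erase i, s j ω * z j with hYdef
  have e : ∀ ω, (s i ω * ∑ j, s j ω * z j) ^ 2 =
      s i ω ^ 4 * z i ^ 2 + (s i ω ^ 3 * Y ω * (2 * z i) + s i ω ^ 2 * Y ω ^ 2) := fun ω => by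
    rw [mul_sum_eq_add_erase]; ring
  have hsi : ∀ k ≤ 8, Integrable (fun ω => s i ω ^ k) P := fun k hk =>
    integrable_pow_of_memLp (p := 8) (by exact_mod_cast h.memLp i) hk
  have hYi : ∀ k ≤ 8, Integrable (fun ω => Y ω ^ k) P := fun k hk =>
    integrable_pow_of_memLp (p := 8) (by exact_mod_cast hY) hk
  have ind3 : IndepFun (fun ω => s i ω ^ 3) Y P :=
    hind.comp (φ := fun x : ℝ => x ^ 3) (ψ := id) (by fun_prop) measurable_id
  have ind2 : IndepFun (fun ω => s i ω ^ 2) (fun ω => Y ω ^ 2) P :=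
    hind.comp (φ := fun x : ℝ => x ^ 2) (ψ := fun x : ℝ => x ^ 2) (by fun_prop) (by fun_prop)
  have i1 : Integrable (fun ω => s i ω ^ 4 * z i ^ 2) P := (hsi 4 (by norm_num)).mul_const _
  have i2 : Integrable (fun ω => s i ω ^ 3 * Y ω * (2 * z i)) P :=
    (ind3.integrable_mul (hsi 3 (by norm_num)) (hY.integrable (by norm_num))).mul_const _
  have i3 : Integrable (fun ω => s i ω ^ 2 * Y ω ^ 2) P :=
    ind2.integrable_mul (hsi 2 (by norm_num)) (hYi 2 (by norm_num))
  have i23 : Integrable (fun ω => s i ω ^ 3 * Y ω * (2 * z i) + s i ω ^ 2 * Y ω ^ 2) P := i2.add i3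
  have hY0 : ∫ ω, Y ω ∂P = 0 := h.integral_sum _ z
  have hY2 : ∫ ω, Y ω ^ 2 ∂P = ∑ j ∈ Finset.univ.erase i, z j ^ 2 := h.integral_sum_sq _ z
  simp_rw [e]
  rw [integral_add i1 i23, integral_add i2 i3, integral_mul_const, integral_mul_const,
    ind3.integral_fun_mul_eq_mul_integral (hsi 3 (by norm_num)).1 hY.1,
    ind2.integral_fun_mul_eq_mul_integral (hsi 2 (by norm_num)).1 (hYi 2 (by norm_num)).1, hY0, hY2,
    h.fourth, h.second, ← Finset.add_sum_erase Finset.univ (fun j => z j ^ 2) (Finset.mem_univ i)]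
  ring

/-- Isolating the `i`-th entry makes the fourth moment of `sᵢ ⟨s, z⟩` depend on eighth moments of
single entries only. -/
lemma integral_mul_sum_pow_four_le (h : IsStandardRow s P C κ) (hC : 1 ≤ C) (i : ι) (z : ι → ℝ) :
    ∫ ω, (s i ω * ∑ j, s j ω * z j) ^ 4 ∂P ≤ 32 * C ^ 2 * (∑ j, z j ^ 2) ^ 2 := by
  classical
  have hY := h.memLp_sum (Finset.univ.erase i) z
  have hind := h.indepFun_sum (Finset.notMem_erase i Finset.univ) z
  have hY4 := h.integral_sum_pow_four_le hC (Finset.univ.erase i) z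
  set Y := fun ω => ∑ j ∈ Finset.univ.erase i, s j ω * z j with hYdef
  have hsi : ∀ k ≤ 8, Integrable (fun ω => s i ω ^ k) P := fun k hk =>
    integrable_pow_of_memLp (p := 8) (by exact_mod_cast h.memLp i) hk
  have hYi : ∀ k ≤ 8, Integrable (fun ω => Y ω ^ k) P := fun k hk =>
    integrable_pow_of_memLp (p := 8) (by exact_mod_cast hY) hk
  have ind4 : IndepFun (fun ω => s i ω ^ 4) (fun ω => Y ω ^ 4) P :=
    hind.comp (φ := fun x : ℝ => x ^ 4) (ψ := fun x : ℝ => x ^ 4) (by fun_prop) (by fun_prop)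
  have i1 : Integrable (fun ω => s i ω ^ 8 * (8 * z i ^ 4)) P := (hsi 8 le_rfl).mul_const _
  have i2 : Integrable (fun ω => s i ω ^ 4 * Y ω ^ 4 * 8) P :=
    (ind4.integrable_mul (hsi 4 (by norm_num)) (hYi 4 (by norm_num))).mul_const _
  have hle : ∫ ω, (s i ω * ∑ j, s j ω * z j) ^ 4 ∂P ≤
      ∫ ω, (s i ω ^ 8 * (8 * z i ^ 4) + s i ω ^ 4 * Y ω ^ 4 * 8) ∂P := by
    refine integral_mono_of_nonneg (.of_forall fun ω => by positivity) (i1.add i2)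
      (.of_forall fun ω => ?_)
    simp only
    rw [mul_sum_eq_add_erase]
    refine (add_pow_four_le _ _).trans_eq ?_
    rw [hYdef]; ring
  rw [integral_add i1 i2, integral_mul_const, integral_mul_const,
    ind4.integral_fun_mul_eq_mul_integral (hsi 4 (by norm_num)).1 (hYi 4 (by norm_num)).1,
    h.fourth] at hle
  set q := ∑ j, z j ^ 2 with hq
  have hzi : z i ^ 2 ≤ q := Finset.single_le_sum (f := fun j => z j ^ 2)
    (fun j _ => sq_nonneg _) (Finset.mem_univ i)
  have hqe : ∑ j ∈ Finset.univ.erase i, z j ^ 2 ≤ q :=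
    Finset.sum_le_sum_of_subset_of_nonneg (Finset.erase_subset _ _) fun j _ _ => sq_nonneg _
  have hq0 : 0 ≤ ∑ j ∈ Finset.univ.erase i, z j ^ 2 := Finset.sum_nonneg fun j _ => sq_nonneg _
  have h1 : z i ^ 4 ≤ q ^ 2 := by
    have := pow_le_pow_left₀ (sq_nonneg (z i)) hzi 2
    linarith [show (z i ^ 2) ^ 2 = z i ^ 4 by ring]
  have h2 : ∫ ω, Y ω ^ 4 ∂P ≤ 3 * C * q ^ 2 :=
    hY4.trans (mul_le_mul_of_nonneg_left (pow_le_pow_left₀ hq0 hqe 2) (by linarith))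
  have h3 : (∫ ω, s i ω ^ 8 ∂P) * (8 * z i ^ 4) ≤ C * (8 * q ^ 2) :=
    mul_le_mul (h.eighth i) (by linarith) (by positivity) (by linarith)
  have h4 : κ * ∫ ω, Y ω ^ 4 ∂P ≤ C * (3 * C * q ^ 2) :=
    mul_le_mul (h.kurtosis_le hC i) h2 (integral_nonneg fun ω => by positivity) (by linarith)
  nlinarith [mul_nonneg (mul_nonneg (by linarith : 0 ≤ C) (sub_nonneg.2 hC)) (sq_nonneg q)]

/-- The quadratic form of `s sᵀ z` against `u` is controlled by the Khintchine inequality, used once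
in each of the two directions. -/
lemma integral_sum_mul_sum_sq_le (h : IsStandardRow s P C κ) (hC : 1 ≤ C) (u z : ι → ℝ) :
    ∫ ω, ((∑ j, s j ω * u j) * ∑ j, s j ω * z j) ^ 2 ∂P ≤
      3 * C * (∑ j, z j ^ 2) * ∑ j, u j ^ 2 := by
  set p := ∑ j, u j ^ 2 with hp
  set q := ∑ j, z j ^ 2 with hq
  have hp0 : 0 ≤ p := Finset.sum_nonneg fun j _ => sq_nonneg _
  have hq0 : 0 ≤ q := Finset.sum_nonneg fun j _ => sq_nonneg _
  rcases hp0.eq_or_lt with hp1 | hp1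
  · have hu : ∀ j, u j = 0 := fun j => by
      have := (Finset.sum_eq_zero_iff_of_nonneg fun j _ => sq_nonneg (u j)).1 hp1.symm j
        (Finset.mem_univ j)
      simpa using this
    simp [hu, ← hp1]
  rcases hq0.eq_or_lt with hq1 | hq1
  · have hz : ∀ j, z j = 0 := fun j => by
      have := (Finset.sum_eq_zero_iff_of_nonneg fun j _ => sq_nonneg (z j)).1 hq1.symm j
        (Finset.mem_univ j)
      simpa using this
    simp [hz, ← hq1]
  have hU := h.integral_sum_pow_four_le hC Finset.univ u
  have hZ := h.integral_sum_pow_four_le hC Finset.univ z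
  have iU : Integrable (fun ω => q / (2 * p) * (∑ j, s j ω * u j) ^ 4) P :=
    (integrable_pow_of_memLp (p := 8) (by exact_mod_cast h.memLp_sum Finset.univ u)
      (by norm_num)).const_mul _
  have iZ : Integrable (fun ω => p / (2 * q) * (∑ j, s j ω * z j) ^ 4) P :=
    (integrable_pow_of_memLp (p := 8) (by exact_mod_cast h.memLp_sum Finset.univ z)
      (by norm_num)).const_mul _
  calc _ ≤ ∫ ω, (q / (2 * p) * (∑ j, s j ω * u j) ^ 4 +
        p / (2 * q) * (∑ j, s j ω * z j) ^ 4) ∂P := by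
        refine integral_mono_of_nonneg (.of_forall fun ω => sq_nonneg _) (iU.add iZ)
          (.of_forall fun ω => ?_)
        simp only
        set A := ∑ j, s j ω * u j
        set B := ∑ j, s j ω * z j
        -- weighted AM-GM, balanced so that both terms have the same size on average
        have e : q / (2 * p) * A ^ 4 + p / (2 * q) * B ^ 4 - (A * B) ^ 2 =
            (q * A ^ 2 - p * B ^ 2) ^ 2 / (2 * p * q) := by field_simp; ring
        have : 0 ≤ (q * A ^ 2 - p * B ^ 2) ^ 2 / (2 * p * q) := by positivity
        linarith
    _ = q / (2 * p) * ∫ ω, (∑ j, s j ω * u j) ^ 4 ∂P +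
        p / (2 * q) * ∫ ω, (∑ j, s j ω * z j) ^ 4 ∂P := by
        rw [integral_add iU iZ, integral_const_mul, integral_const_mul]
    _ ≤ q / (2 * p) * (3 * C * p ^ 2) + p / (2 * q) * (3 * C * q ^ 2) := by gcongr
    _ = 3 * C * q * p := by field_simp; ring

end IsStandardRow
end Row

section RowVector
open scoped RealInnerProductSpace
variable {Ω : Type*} {ι : Type*} [Fintype ι]

/-- The centred vector `s sᵀ z - z`, where `s` is a random row. -/
noncomputable def rowFluctuation (s : ι → Ω → ℝ) (z : ι → ℝ) (ω : Ω) : EuclideanSpace ℝ ι :=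
  WithLp.toLp 2 fun i => s i ω * ∑ j, s j ω * z j - z i

lemma rowFluctuation_apply (s : ι → Ω → ℝ) (z : ι → ℝ) (ω : Ω) (i : ι) :
    rowFluctuation s z ω i = s i ω * ∑ j, s j ω * z j - z i := rfl

/-- The `i`-th coordinate of `Sᵀ S z`. -/
def gramMulVec {γ : Type*} [Fintype γ] (S : γ → ι → ℝ) (z : ι → ℝ)
    (i : ι) : ℝ := ∑ k, S k i * ∑ j, S k j * z j

lemma gramMulVec_eq {γ : Type*} [Fintype γ] (S : γ → ι → Ω → ℝ) (z : ι → ℝ) (ω : Ω) (i : ι) :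
    gramMulVec (fun k i => S k i ω) z i =
      Fintype.card γ * z i + ∑ k, rowFluctuation (S k) z ω i := by
  simp_rw [gramMulVec, rowFluctuation_apply]
  rw [Finset.sum_sub_distrib, Finset.sum_const, Finset.card_univ, nsmul_eq_mul]
  ring

variable [MeasurableSpace Ω] {P : Measure Ω} {s : ι → Ω → ℝ} {C κ : ℝ}

variable {γ : Type*} {S : γ → ι → Ω → ℝ}

/-- A random matrix with independent rows, each of which is a standardised row. -/
structure IsStandardMatrix (S : γ → ι → Ω → ℝ) (P : Measure Ω) (C κ : ℝ) : Prop where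
  indep : iIndepFun (fun k ω i => S k i ω) P
  row : ∀ k, IsStandardRow (S k) P C κ

lemma IsStandardMatrix.indep_rowFluctuation (h : IsStandardMatrix S P C κ) (z : ι → ℝ) :
    iIndepFun (fun k => rowFluctuation (S k) z) P :=
  h.indep.comp (fun _ x => WithLp.toLp 2 fun i => x i * ∑ j, x j * z j - z i) fun _ => by fun_prop

variable [IsProbabilityMeasure P]

namespace IsStandardRow

lemma memLp_rowFluctuation_apply (h : IsStandardRow s P C κ) (z : ι → ℝ) (i : ι) :
    MemLp (fun ω => rowFluctuation s z ω i) 4 P :=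
  (h.memLp_mul_sum i z).sub (memLp_const (z i))

lemma memLp_rowFluctuation (h : IsStandardRow s P C κ) (z : ι → ℝ) :
    MemLp (rowFluctuation s z) 4 P :=
  MemLp.of_eval_piLp fun i => h.memLp_rowFluctuation_apply z i

lemma integral_rowFluctuation_apply (h : IsStandardRow s P C κ) (z : ι → ℝ) (i : ι) :
    ∫ ω, rowFluctuation s z ω i ∂P = 0 := by
  simp_rw [rowFluctuation_apply]
  rw [integral_sub ((h.memLp_mul_sum i z).integrable (by norm_num)) (integrable_const _),
    h.integral_mul_sum]
  simp

lemma integral_rowFluctuation (h : IsStandardRow s P C κ) (z : ι → ℝ) :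
    ∫ ω, rowFluctuation s z ω ∂P = 0 := by
  ext i
  rw [eval_integral_piLp fun i => (h.memLp_rowFluctuation_apply z i).integrable (by norm_num),
    h.integral_rowFluctuation_apply]
  rfl

lemma integral_norm_rowFluctuation_sq (h : IsStandardRow s P C κ) (z : ι → ℝ) :
    ∫ ω, ‖rowFluctuation s z ω‖ ^ 2 ∂P = (Fintype.card ι + κ - 2) * ∑ j, z j ^ 2 := by
  simp_rw [EuclideanSpace.real_norm_sq_eq]
  rw [integral_finsetSum _ fun i _ => ((h.memLp_rowFluctuation_apply z i).mono_exponent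
    (by norm_num : (2 : ENNReal) ≤ 4)).integrable_sq]
  have e : ∀ i, ∫ ω, rowFluctuation s z ω i ^ 2 ∂P = (κ - 2) * z i ^ 2 + ∑ j, z j ^ 2 := by
    intro i
    have hm := h.memLp_mul_sum i z
    have i1 : Integrable (fun ω => (s i ω * ∑ j, s j ω * z j) ^ 2) P :=
      (hm.mono_exponent (by norm_num : (2 : ENNReal) ≤ 4)).integrable_sq
    have i2 : Integrable (fun ω => 2 * z i * (s i ω * ∑ j, s j ω * z j)) P :=
      (hm.integrable (by norm_num)).const_mul _
    have i3 : Integrable (fun ω => 2 * z i * (s i ω * ∑ j, s j ω * z j) - z i ^ 2) P :=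
      i2.sub (integrable_const _)
    have e : ∀ ω, rowFluctuation s z ω i ^ 2 = (s i ω * ∑ j, s j ω * z j) ^ 2 -
        (2 * z i * (s i ω * ∑ j, s j ω * z j) - z i ^ 2) := fun ω => by
      rw [rowFluctuation_apply]; ring
    simp_rw [e]
    rw [integral_sub i1 i3, integral_sub i2 (integrable_const _), integral_const_mul,
      h.integral_mul_sum, h.integral_mul_sum_sq]
    simp
    ring
  simp_rw [e]
  rw [Finset.sum_add_distrib, ← Finset.mul_sum, Finset.sum_const, Finset.card_univ, nsmul_eq_mul]
  ring

lemma integral_rowFluctuation_apply_pow_four_le (h : IsStandardRow s P C κ) (hC : 1 ≤ C)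
    (z : ι → ℝ) (i : ι) :
    ∫ ω, rowFluctuation s z ω i ^ 4 ∂P ≤ (17 * C * ∑ j, z j ^ 2) ^ 2 := by
  have hm := h.memLp_mul_sum i z
  have i1 : Integrable (fun ω => (s i ω * ∑ j, s j ω * z j) ^ 4) P :=
    integrable_pow_of_memLp (p := 4) (by exact_mod_cast hm) le_rfl
  have hle : ∫ ω, rowFluctuation s z ω i ^ 4 ∂P ≤
      ∫ ω, 8 * ((s i ω * ∑ j, s j ω * z j) ^ 4 + z i ^ 4) ∂P := by
    refine integral_mono_of_nonneg (.of_forall fun ω => by positivity)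
      ((i1.add (integrable_const _)).const_mul 8) (.of_forall fun ω => ?_)
    simp only
    rw [rowFluctuation_apply, sub_eq_add_neg]
    refine (add_pow_four_le _ _).trans_eq ?_
    ring
  rw [integral_const_mul, integral_add i1 (integrable_const _)] at hle
  simp only [integral_const, probReal_univ, one_smul] at hle
  have h1 := h.integral_mul_sum_pow_four_le hC i z
  set q := ∑ j, z j ^ 2 with hq
  have hzi : z i ^ 2 ≤ q := Finset.single_le_sum (f := fun j => z j ^ 2)
    (fun j _ => sq_nonneg _) (Finset.mem_univ i)
  have h2 : z i ^ 4 ≤ q ^ 2 := by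
    have := pow_le_pow_left₀ (sq_nonneg (z i)) hzi 2
    linarith [show (z i ^ 2) ^ 2 = z i ^ 4 by ring]
  have h3 : q ^ 2 ≤ C ^ 2 * q ^ 2 := le_mul_of_one_le_left (sq_nonneg q) (one_le_pow₀ hC)
  have h4 : (17 * C * q) ^ 2 = 289 * (C ^ 2 * q ^ 2) := by ring
  rw [h4]
  nlinarith [mul_nonneg (sq_nonneg C) (sq_nonneg q)]

lemma integral_norm_rowFluctuation_pow_four_le (h : IsStandardRow s P C κ) (hC : 1 ≤ C)
    (z : ι → ℝ) : ∫ ω, ‖rowFluctuation s z ω‖ ^ 4 ∂P ≤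
      (Fintype.card ι : ℝ) ^ 2 * (17 * C * ∑ j, z j ^ 2) ^ 2 := by
  have hi : ∀ i ∈ Finset.univ, Integrable (fun ω => rowFluctuation s z ω i ^ 4) P := fun i _ =>
    integrable_pow_of_memLp (p := 4) (by exact_mod_cast h.memLp_rowFluctuation_apply z i) le_rfl
  have hle : ∫ ω, ‖rowFluctuation s z ω‖ ^ 4 ∂P ≤
      ∫ ω, (Fintype.card ι : ℝ) * ∑ i, rowFluctuation s z ω i ^ 4 ∂P := by
    refine integral_mono_of_nonneg (.of_forall fun ω => by positivity)
      ((integrable_finsetSum _ hi).const_mul _) (.of_forall fun ω => ?_)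
    have e : ‖rowFluctuation s z ω‖ ^ 4 = (∑ i, rowFluctuation s z ω i ^ 2) ^ 2 := by
      rw [← EuclideanSpace.real_norm_sq_eq]; ring
    simp only [e]
    refine (sq_sum_le_card_mul_sum_sq).trans_eq ?_
    rw [Finset.card_univ]
    congr 1
    exact Finset.sum_congr rfl fun i _ => by ring
  refine hle.trans ?_
  rw [integral_const_mul, integral_finsetSum _ hi, sq (Fintype.card ι : ℝ), mul_assoc]
  refine mul_le_mul_of_nonneg_left ?_ (Nat.cast_nonneg _)
  refine (Finset.sum_le_sum fun i _ => h.integral_rowFluctuation_apply_pow_four_le hC z i).trans_eq ?_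
  rw [Finset.sum_const, Finset.card_univ, nsmul_eq_mul]

lemma integral_inner_rowFluctuation_sq_le (h : IsStandardRow s P C κ) (hC : 1 ≤ C)
    (z : ι → ℝ) (u : EuclideanSpace ℝ ι) :
    ∫ ω, ⟪u, rowFluctuation s z ω⟫ ^ 2 ∂P ≤ 3 * C * (∑ j, z j ^ 2) * ‖u‖ ^ 2 := by
  have hform := h.integral_sum_mul_sum_sq_le hC u z
  rw [EuclideanSpace.real_norm_sq_eq u]
  refine le_trans ?_ hform
  set d := ∑ i, z i * u i with hd
  have hprod : MemLp (fun ω => (∑ j, s j ω * u j) * ∑ j, s j ω * z j) 4 P :=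
    memLp_four_mul (h.memLp_sum _ _) (h.memLp_sum _ _)
  have e1 : ∀ ω, ⟪u, rowFluctuation s z ω⟫ = (∑ j, s j ω * u j) * (∑ j, s j ω * z j) - d := by
    intro ω
    rw [PiLp.inner_apply, hd, Finset.sum_mul, ← Finset.sum_sub_distrib]
    refine Finset.sum_congr rfl fun i _ => ?_
    rw [rowFluctuation_apply]
    simp only [RCLike.inner_apply, conj_trivial]
    ring
  have hmean : ∫ ω, (∑ j, s j ω * u j) * (∑ j, s j ω * z j) ∂P = d := by
    have h0 := integral_inner_eq_zero (h.memLp_rowFluctuation z) (h.integral_rowFluctuation z) u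
    simp_rw [e1] at h0
    rw [integral_sub (hprod.integrable (by norm_num)) (integrable_const _)] at h0
    simp at h0
    linarith
  simp_rw [e1]
  have i2 := (hprod.mono_exponent (by norm_num : (2 : ENNReal) ≤ 4)).integrable_sq
  have i1 : Integrable (fun ω => 2 * d * ((∑ j, s j ω * u j) * ∑ j, s j ω * z j)) P :=
    (hprod.integrable (by norm_num)).const_mul _
  have i3 : Integrable (fun ω => 2 * d * ((∑ j, s j ω * u j) * ∑ j, s j ω * z j) - d ^ 2) P :=
    i1.sub (integrable_const _)
  have e2 : ∀ ω, ((∑ j, s j ω * u j) * (∑ j, s j ω * z j) - d) ^ 2 =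
      ((∑ j, s j ω * u j) * (∑ j, s j ω * z j)) ^ 2 -
        (2 * d * ((∑ j, s j ω * u j) * ∑ j, s j ω * z j) - d ^ 2) := fun ω => by ring
  simp_rw [e2]
  rw [integral_sub i2 i3, integral_sub i1 (integrable_const _), integral_const_mul, hmean]
  simp only [integral_const, probReal_univ, one_smul]
  nlinarith [sq_nonneg d]

end IsStandardRow

/-! ### The vector `Sᵀ S z` for deterministic `z` -/

variable [Fintype γ]

namespace IsStandardMatrix

lemma integral_gramMulVec_pow_four_le (h : IsStandardMatrix S P C κ) (hC : 1 ≤ C) (z : ι → ℝ)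
    (i : ι) : ∫ ω, gramMulVec (fun k i => S k i ω) z i ^ 4 ∂P ≤
      8 * ((Fintype.card γ : ℝ) ^ 4 * z i ^ 4 +
        867 * C ^ 2 * (Fintype.card γ : ℝ) ^ 2 * (∑ j, z j ^ 2) ^ 2) := by
  have hq0 : 0 ≤ ∑ j, z j ^ 2 := Finset.sum_nonneg fun j _ => sq_nonneg _
  have hm : ∀ k, MemLp (fun ω => rowFluctuation (S k) z ω i) 4 P := fun k =>
    (h.row k).memLp_rowFluctuation_apply z i
  have hind : iIndepFun (fun k ω => rowFluctuation (S k) z ω i) P :=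
    (h.indep_rowFluctuation z).comp (fun _ x => x i) fun _ => by fun_prop
  have h4 := integral_pow_four_sum_le hind hm
    (fun k => (h.row k).integral_rowFluctuation_apply z i)
    (c := fun _ => 17 * C * ∑ j, z j ^ 2) (fun _ => mul_nonneg (by linarith) hq0)
    (fun k => (h.row k).integral_rowFluctuation_apply_pow_four_le hC z i) Finset.univ
  rw [Finset.sum_const, Finset.card_univ, nsmul_eq_mul] at h4
  have i1 : Integrable (fun ω => (∑ k, rowFluctuation (S k) z ω i) ^ 4) P :=
    integrable_pow_of_memLp (p := 4) (by exact_mod_cast memLp_finsetSum Finset.univ fun k _ => hm k)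
      le_rfl
  have hle : ∫ ω, gramMulVec (fun k i => S k i ω) z i ^ 4 ∂P ≤
      ∫ ω, 8 * (((Fintype.card γ : ℝ) * z i) ^ 4 + (∑ k, rowFluctuation (S k) z ω i) ^ 4) ∂P := by
    refine integral_mono_of_nonneg (.of_forall fun ω => by positivity)
      (((integrable_const _).add i1).const_mul 8) (.of_forall fun ω => ?_)
    simp only [gramMulVec_eq]
    exact add_pow_four_le _ _
  rw [integral_const_mul, integral_add (integrable_const _) i1] at hle
  simp only [integral_const, probReal_univ, one_smul] at hle
  refine hle.trans ?_
  rw [mul_pow]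
  refine mul_le_mul_of_nonneg_left (add_le_add le_rfl (h4.trans_eq ?_)) (by norm_num)
  ring

/-- For deterministic `z`, the squared length of `Sᵀ S z` concentrates: writing
`Sᵀ S z = m z + R` with `R` a sum of independent centred vectors, the two fluctuating terms are
`2 m ⟨z, R⟩` and `‖R‖² - E ‖R‖²`. -/
lemma integral_sum_gramMulVec_sq_sub_sq_le (h : IsStandardMatrix S P C κ) (hC : 1 ≤ C)
    (z : ι → ℝ) {m n : ℝ} (hm : m = Fintype.card γ) (hn : n = Fintype.card ι) (hκ : κ ≤ C)
    (hn1 : 1 ≤ n) : 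
    ∫ ω, (∑ i, gramMulVec (fun k i => S k i ω) z i ^ 2 -
        (m ^ 2 + m * (n + κ - 2)) * ∑ j, z j ^ 2) ^ 2 ∂P ≤
      1252 * C ^ 2 * (m ^ 3 + m ^ 2 * n + m * n ^ 2) * (∑ j, z j ^ 2) ^ 2 := by
  set q := ∑ j, z j ^ 2 with hq
  have hq0 : 0 ≤ q := Finset.sum_nonneg fun j _ => sq_nonneg _
  have hC0 : 0 ≤ C := by linarith
  have hm0 : 0 ≤ m := by rw [hm]; positivity
  set η : γ → Ω → EuclideanSpace ℝ ι := fun k => rowFluctuation (S k) z with hη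
  have hηL : ∀ k, MemLp (η k) 4 P := fun k => (h.row k).memLp_rowFluctuation z
  have hη0 : ∀ k, ∫ ω, η k ω ∂P = 0 := fun k => (h.row k).integral_rowFluctuation z
  have hb : ∀ k (u : EuclideanSpace ℝ ι), ∫ ω, ⟪u, η k ω⟫ ^ 2 ∂P ≤ 3 * C * q * ‖u‖ ^ 2 :=
    fun k u => (h.row k).integral_inner_rowFluctuation_sq_le hC z u
  have hquad := (integral_norm_sq_sum_sub_sq_le (h.indep_rowFluctuation z) hηL hη0
    (fun k => (h.row k).integral_norm_rowFluctuation_sq z)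
    (fun k => (h.row k).integral_norm_rowFluctuation_pow_four_le hC z)
    (mul_nonneg (mul_nonneg (by norm_num) hC0) hq0) hb Finset.univ).2
  rw [Finset.card_univ, ← hm, ← hn, ← hq] at hquad
  set z' : EuclideanSpace ℝ ι := WithLp.toLp 2 z with hz'
  have hz'n : ‖z'‖ ^ 2 = q := by rw [EuclideanSpace.real_norm_sq_eq]
  have hWL : ∀ k, MemLp (fun ω => ⟪z', η k ω⟫) 4 P := fun k =>
    (hηL k).const_inner z'
  have hlin : ∫ ω, (∑ k, ⟪z', η k ω⟫) ^ 2 ∂P ≤ m * (3 * C * q * q) := by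
    rw [integral_sq_sum_of_iIndepFun (W := fun k ω => ⟪z', η k ω⟫)
      ((h.indep_rowFluctuation z).comp (fun _ x => ⟪z', x⟫) fun _ => by fun_prop)
      (fun k => (hWL k).mono_exponent (by norm_num))
      (fun k => integral_inner_eq_zero (hηL k) (hη0 k) z')]
    refine (Finset.sum_le_sum fun k _ => hb k z').trans_eq ?_
    rw [Finset.sum_const, Finset.card_univ, nsmul_eq_mul, ← hm, hz'n]
  set R : Ω → EuclideanSpace ℝ ι := fun ω => ∑ k, η k ω with hR
  have hRL : MemLp R 4 P := memLp_finsetSum Finset.univ fun k _ => hηL k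
  have hexp : ∀ ω, ∑ i, gramMulVec (fun k i => S k i ω) z i ^ 2 =
      m ^ 2 * q + 2 * m * (∑ k, ⟪z', η k ω⟫) + ‖R ω‖ ^ 2 := by
    intro ω
    have e1 : ∑ i, gramMulVec (fun k i => S k i ω) z i ^ 2 = ‖m • z' + R ω‖ ^ 2 := by
      rw [EuclideanSpace.real_norm_sq_eq]
      refine Finset.sum_congr rfl fun i _ => ?_
      rw [gramMulVec_eq, ← hm]
      simp [hR, hη, hz']
    rw [e1, norm_add_sq_real, norm_smul, mul_pow, hz'n, real_inner_smul_left, hR, inner_sum,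
      Real.norm_eq_abs, sq_abs]
    ring
  set τ := (n + κ - 2) * q with hτ
  have hτle : τ ≤ 2 * C * n * q := by
    refine mul_le_mul_of_nonneg_right ?_ hq0
    nlinarith
  have i1 : Integrable (fun ω => 8 * m ^ 2 * (∑ k, ⟪z', η k ω⟫) ^ 2) P :=
    (((memLp_finsetSum Finset.univ fun k _ => hWL k).mono_exponent
      (by norm_num : (2 : ENNReal) ≤ 4)).integrable_sq).const_mul _
  have i2 : Integrable (fun ω => 2 * (‖R ω‖ ^ 2 - m * τ) ^ 2) P :=
    (((memLp_norm_sq hRL).sub (memLp_const (m * τ))).integrable_sq).const_mul 2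
  have hle : ∫ ω, (∑ i, gramMulVec (fun k i => S k i ω) z i ^ 2 -
        (m ^ 2 + m * (n + κ - 2)) * q) ^ 2 ∂P ≤
      ∫ ω, (8 * m ^ 2 * (∑ k, ⟪z', η k ω⟫) ^ 2 + 2 * (‖R ω‖ ^ 2 - m * τ) ^ 2) ∂P := by
    refine integral_mono_of_nonneg (.of_forall fun ω => sq_nonneg _) (i1.add i2)
      (.of_forall fun ω => ?_)
    simp only [hexp, hτ]
    nlinarith [sq_nonneg (2 * m * (∑ k, ⟪z', η k ω⟫) - (‖R ω‖ ^ 2 - m * ((n + κ - 2) * q)))]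
  rw [integral_add i1 i2, integral_const_mul, integral_const_mul] at hle
  calc _ ≤ _ := hle
    _ ≤ 8 * m ^ 2 * (m * (3 * C * q * q)) + 2 * (8 * (3 * C * q) * (2 * C * n * q) * m ^ 2 +
        2 * (n ^ 2 * (17 * C * q) ^ 2) * m) := by
      have h1 : 8 * (3 * C * q) * τ * m ^ 2 ≤ 8 * (3 * C * q) * (2 * C * n * q) * m ^ 2 := by gcongr
      have h2 := mul_le_mul_of_nonneg_left hlin (by positivity : 0 ≤ 8 * m ^ 2)
      linarith
    _ = 24 * C * (m ^ 3 * q ^ 2) + 96 * C ^ 2 * (m ^ 2 * n * q ^ 2) +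
        1156 * C ^ 2 * (m * n ^ 2 * q ^ 2) := by ring
    _ ≤ 1252 * C ^ 2 * (m ^ 3 * q ^ 2) + 1252 * C ^ 2 * (m ^ 2 * n * q ^ 2) +
        1252 * C ^ 2 * (m * n ^ 2 * q ^ 2) := by
      have : 24 * C ≤ 1252 * C ^ 2 := by nlinarith
      gcongr <;> norm_num
    _ = _ := by ring

end IsStandardMatrix
end RowVector

/-! ### Random `z` -/

lemma integrable_prod_of_integral_le {α β : Type*} [MeasurableSpace α] [MeasurableSpace β]
    {μ : Measure α} {ν : Measure β} [IsProbabilityMeasure μ] [IsProbabilityMeasure ν]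
    {F : α × β → ℝ} (hF : Measurable F) (hF0 : ∀ p, 0 ≤ F p)
    (hFi : ∀ x, Integrable (fun y => F (x, y)) ν) {G : α → ℝ} (hG : Integrable G μ)
    (hle : ∀ x, ∫ y, F (x, y) ∂ν ≤ G x) :
    Integrable F (μ.prod ν) ∧ ∫ p, F p ∂(μ.prod ν) ≤ ∫ x, G x ∂μ := by
  have hi : Integrable F (μ.prod ν) := by
    refine (integrable_prod_iff hF.aestronglyMeasurable).2 ⟨.of_forall hFi, ?_⟩
    refine hG.mono' hF.aestronglyMeasurable.norm.integral_prod_right' (.of_forall fun x => ?_)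
    simp_rw [Real.norm_of_nonneg (hF0 _)]
    rw [Real.norm_of_nonneg (integral_nonneg fun y => hF0 _)]
    exact hle x
  refine ⟨hi, ?_⟩
  rw [integral_prod _ hi]
  exact integral_mono hi.integral_prod_left hG hle

section RandomVector
variable {Ω : Type*} [MeasurableSpace Ω] {P : Measure Ω} {ι : Type*}

/-- Independent standardised variables with fourth moment at most `C`. -/
structure IsStandardVector (z : ι → Ω → ℝ) (P : Measure Ω) (C : ℝ) : Prop where
  indep : iIndepFun z P
  memLp : ∀ i, MemLp (z i) 4 P
  second : ∀ i, ∫ ω, z i ω ^ 2 ∂P = 1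
  fourth : ∀ i, ∫ ω, z i ω ^ 4 ∂P ≤ C

variable [IsProbabilityMeasure P] {z : ι → Ω → ℝ} {C : ℝ}

namespace IsStandardVector

lemma integrable_pow_four (h : IsStandardVector z P C) (i : ι) :
    Integrable (fun ω => z i ω ^ 4) P :=
  integrable_pow_of_memLp (p := 4) (by exact_mod_cast h.memLp i) le_rfl

lemma memLp_sq (h : IsStandardVector z P C) (i : ι) : MemLp (fun ω => z i ω ^ 2) 2 P :=
  memLp_sq_of_memLp_four (h.memLp i)

variable [Fintype ι]

lemma memLp_sum_sq (h : IsStandardVector z P C) : MemLp (fun ω => ∑ i, z i ω ^ 2) 2 P :=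
  memLp_finsetSum Finset.univ fun i _ => h.memLp_sq i

lemma integral_sum_sq_sq_le (h : IsStandardVector z P C) :
    ∫ ω, (∑ i, z i ω ^ 2) ^ 2 ∂P ≤ C * (Fintype.card ι : ℝ) ^ 2 := by
  have hi : ∀ i ∈ Finset.univ, Integrable (fun ω => z i ω ^ 4) P := fun i _ =>
    h.integrable_pow_four i
  have hle : ∫ ω, (∑ i, z i ω ^ 2) ^ 2 ∂P ≤ ∫ ω, (Fintype.card ι : ℝ) * ∑ i, z i ω ^ 4 ∂P := by
    refine integral_mono h.memLp_sum_sq.integrable_sq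
      ((integrable_finsetSum _ hi).const_mul _) fun ω => ?_
    refine sq_sum_le_card_mul_sum_sq.trans_eq ?_
    rw [Finset.card_univ]
    congr 1
    exact Finset.sum_congr rfl fun i _ => by ring
  refine hle.trans ?_
  rw [integral_const_mul, integral_finsetSum _ hi]
  have : ∑ i, ∫ ω, z i ω ^ 4 ∂P ≤ Fintype.card ι * C := by
    refine (Finset.sum_le_sum fun i _ => h.fourth i).trans_eq ?_
    rw [Finset.sum_const, Finset.card_univ, nsmul_eq_mul]
  refine (mul_le_mul_of_nonneg_left this (Nat.cast_nonneg _)).trans_eq ?_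
  ring

lemma integral_sum_sq_sub_card_sq_le (h : IsStandardVector z P C) :
    ∫ ω, (∑ i, z i ω ^ 2 - Fintype.card ι) ^ 2 ∂P ≤ C * Fintype.card ι := by
  have e : ∀ ω, ∑ i, z i ω ^ 2 - (Fintype.card ι : ℝ) = ∑ i, (z i ω ^ 2 - 1) := fun ω => by
    rw [Finset.sum_sub_distrib]; simp
  have hL : ∀ i, MemLp (fun ω => z i ω ^ 2 - 1) 2 P := fun i => (h.memLp_sq i).sub (memLp_const 1)
  have hz2 : ∀ i, Integrable (fun ω => z i ω ^ 2) P := fun i =>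
    (h.memLp_sq i).integrable (by norm_num)
  simp_rw [e]
  rw [integral_sq_sum_of_iIndepFun (W := fun i ω => z i ω ^ 2 - 1)
    (h.indep.comp (fun _ x => x ^ 2 - 1) fun _ => by fun_prop) hL
    (fun i => by rw [integral_sub (hz2 i) (integrable_const 1), h.second]; simp)]
  have : ∀ i, ∫ ω, (z i ω ^ 2 - 1) ^ 2 ∂P ≤ C := by
    intro i
    have i1 : Integrable (fun ω => 2 * z i ω ^ 2) P := (hz2 i).const_mul 2
    have i2 : Integrable (fun ω => 2 * z i ω ^ 2 - 1) P := i1.sub (integrable_const 1)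
    have e : ∀ ω, (z i ω ^ 2 - 1) ^ 2 = z i ω ^ 4 - (2 * z i ω ^ 2 - 1) := fun ω => by ring
    simp_rw [e]
    rw [integral_sub (h.integrable_pow_four i) i2, integral_sub i1 (integrable_const 1),
      integral_const_mul, h.second]
    have := h.fourth i
    simp
    linarith
  refine (Finset.sum_le_sum fun i _ => this i).trans_eq ?_
  rw [Finset.sum_const, Finset.card_univ, nsmul_eq_mul, mul_comm]

end IsStandardVector
end RandomVector

lemma IsStandardMatrix.memLp_gramMulVec {β ι γ : Type*} [MeasurableSpace β]
    {ν : Measure β} [Fintype ι] [Fintype γ] {S : γ → ι → β → ℝ} {C κ : ℝ} (h : IsStandardMatrix S ν C κ) (z : ι → ℝ) (i : ι) :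
    MemLp (fun ω => gramMulVec (fun k i => S k i ω) z i) 4 ν :=
  memLp_finsetSum Finset.univ fun k _ => (h.row k).memLp_mul_sum i z

section Gram
variable {α β : Type*} [MeasurableSpace α] [MeasurableSpace β] {μ : Measure α} {ν : Measure β}
  [IsProbabilityMeasure μ] [IsProbabilityMeasure ν] {ι γ : Type*} [Fintype ι] [Fintype γ]
  {z : ι → α → ℝ} {S : γ → ι → β → ℝ} {C κ m n : ℝ}

lemma measurable_gramMulVec (hz : ∀ i, Measurable (z i)) (hS : ∀ k i, Measurable (S k i)) (i : ι) :
    Measurable fun p : α × β => gramMulVec (fun k i => S k i p.2) (fun j => z j p.1) i := by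
  unfold gramMulVec
  fun_prop

lemma integral_gramMulVec_pow_four_prod_le (hz : IsStandardVector z μ C)
    (hS : IsStandardMatrix S ν C κ) (hzm : ∀ i, Measurable (z i)) (hSm : ∀ k i, Measurable (S k i))
    (hC : 1 ≤ C) (hm : m = Fintype.card γ) (hn : n = Fintype.card ι) (i : ι) :
    Integrable (fun p : α × β => gramMulVec (fun k i => S k i p.2) (fun j => z j p.1) i ^ 4)
      (μ.prod ν) ∧
    ∫ p : α × β, gramMulVec (fun k i => S k i p.2) (fun j => z j p.1) i ^ 4 ∂(μ.prod ν) ≤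
      6944 * C ^ 3 * (m ^ 2 * (m ^ 2 + n ^ 2)) := by
  have i1 : Integrable (fun x => m ^ 4 * z i x ^ 4) μ := (hz.integrable_pow_four i).const_mul _
  have i2 : Integrable (fun x => 867 * C ^ 2 * m ^ 2 * (∑ j, z j x ^ 2) ^ 2) μ :=
    hz.memLp_sum_sq.integrable_sq.const_mul _
  have h := integrable_prod_of_integral_le (μ := μ) (ν := ν)
    (F := fun p : α × β => gramMulVec (fun k i => S k i p.2) (fun j => z j p.1) i ^ 4)
    ((measurable_gramMulVec hzm hSm i).pow_const 4) (fun p => by positivity)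
    (fun x => integrable_pow_of_memLp (p := 4)
      (by exact_mod_cast hS.memLp_gramMulVec (fun j => z j x) i) le_rfl)
    ((i1.add i2).const_mul 8)
    (fun x => by
      simp only [Pi.add_apply]
      rw [hm]
      exact hS.integral_gramMulVec_pow_four_le hC (fun j => z j x) i)
  refine ⟨h.1, h.2.trans ?_⟩
  simp only [Pi.add_apply]
  rw [integral_const_mul, integral_add i1 i2, integral_const_mul, integral_const_mul]
  have h1 := hz.fourth i
  have h2 := hz.integral_sum_sq_sq_le
  rw [← hn] at h2
  have hC3 : C ≤ C ^ 3 := le_self_pow₀ hC (by norm_num)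
  calc _ ≤ 8 * (m ^ 4 * C + 867 * C ^ 2 * m ^ 2 * (C * n ^ 2)) := by gcongr
    _ ≤ 8 * (m ^ 4 * C ^ 3 + 867 * C ^ 2 * m ^ 2 * (C * n ^ 2)) := by gcongr
    _ ≤ 8 * (868 * (m ^ 4 * C ^ 3) + 868 * (C ^ 3 * m ^ 2 * n ^ 2)) := by
      have : 0 ≤ m ^ 4 * C ^ 3 := by positivity
      have : 0 ≤ C ^ 3 * m ^ 2 * n ^ 2 := by positivity
      nlinarith
    _ = _ := by ring

/-- With `q = |z|²` and `V = |SᵀSz|²`, the deviation of `V` from `m² n + m n²` splits into the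
fluctuation given `z`, the fluctuation of `q`, and a lower-order bias from the kurtosis `κ`. -/
lemma sq_sub_le_of_kurtosis_split (V q m n κ : ℝ) : (V - (m ^ 2 * n + m * n ^ 2)) ^ 2 ≤
    3 * (V - (m ^ 2 + m * (n + κ - 2)) * q) ^ 2 +
      (3 * (m ^ 2 + m * n) ^ 2 * (q - n) ^ 2 + 3 * (m ^ 2 * (κ - 2) ^ 2) * q ^ 2) := by
  have e : V - (m ^ 2 * n + m * n ^ 2) = (V - (m ^ 2 + m * (n + κ - 2)) * q) +
      (m ^ 2 + m * n) * (q - n) + m * (κ - 2) * q := by ring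
  rw [e]
  set A := V - (m ^ 2 + m * (n + κ - 2)) * q
  have e2 : 3 * (m ^ 2 + m * n) ^ 2 * (q - n) ^ 2 = 3 * ((m ^ 2 + m * n) * (q - n)) ^ 2 := by ring
  have e3 : 3 * (m ^ 2 * (κ - 2) ^ 2) * q ^ 2 = 3 * (m * (κ - 2) * q) ^ 2 := by ring
  rw [e2, e3]
  set B := (m ^ 2 + m * n) * (q - n)
  set D := m * (κ - 2) * q
  nlinarith [sq_nonneg (A - B), sq_nonneg (B - D), sq_nonneg (A - D)]

/-- All contributions to the variance are of order `(m² n + m n²)² (1 / n + 1 / m) = m n (m + n)³`. -/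
lemma gram_variance_terms_le {C m n : ℝ} (hC : 1 ≤ C) (hm1 : 1 ≤ m) (hn1 : 1 ≤ n) :
    3 * (1252 * C ^ 2 * (m ^ 3 + m ^ 2 * n + m * n ^ 2) * (C * n ^ 2)) +
      (3 * (m ^ 2 + m * n) ^ 2 * (C * n) + 3 * (m ^ 2 * (4 * C ^ 2)) * (C * n ^ 2)) ≤
    3771 * C ^ 3 * (m * n * (m + n) ^ 3) := by
  have hC3 : C ≤ C ^ 3 := le_self_pow₀ hC (by norm_num)
  have b1 : (m ^ 3 + m ^ 2 * n + m * n ^ 2) * n ^ 2 ≤ m * n * (m + n) ^ 3 := by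
    have : 0 ≤ m * n * (m ^ 3 + 2 * m ^ 2 * n + 2 * m * n ^ 2) := by positivity
    nlinarith
  have b2 : (m ^ 2 + m * n) ^ 2 * n ≤ m * n * (m + n) ^ 3 := by
    have : 0 ≤ m * n * (n * (m + n) ^ 2) := by positivity
    nlinarith
  have b3 : m ^ 2 * n ^ 2 ≤ m * n * (m + n) ^ 3 := by
    have h1 : m ^ 2 * n ^ 2 ≤ m * n * (m + n) ^ 2 := by
      have : 0 ≤ m * n * (m ^ 2 + m * n + n ^ 2) := by positivity
      nlinarith
    have h2 : (m + n) ^ 2 ≤ (m + n) ^ 3 := pow_le_pow_right₀ (by linarith) (by norm_num)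
    exact h1.trans (mul_le_mul_of_nonneg_left h2 (by positivity))
  calc _ = 3756 * C ^ 3 * ((m ^ 3 + m ^ 2 * n + m * n ^ 2) * n ^ 2) +
        3 * C * ((m ^ 2 + m * n) ^ 2 * n) + 12 * C ^ 3 * (m ^ 2 * n ^ 2) := by ring
    _ ≤ 3756 * C ^ 3 * (m * n * (m + n) ^ 3) + 3 * C ^ 3 * (m * n * (m + n) ^ 3) +
        12 * C ^ 3 * (m * n * (m + n) ^ 3) := by gcongr
    _ = _ := by ring

lemma integral_sq_sub_le_of_kurtosis_split {Q : α × β → ℝ} {q : α → ℝ} {k T₁ T₂ T₃ : ℝ}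
    (hQ : Measurable Q) (hq : MemLp q 2 μ) (hk : (κ - 2) ^ 2 ≤ k)
    (hi : Integrable (fun p => (Q p - (m ^ 2 + m * (n + κ - 2)) * q p.1) ^ 2) (μ.prod ν))
    (h₁ : ∫ p, (Q p - (m ^ 2 + m * (n + κ - 2)) * q p.1) ^ 2 ∂(μ.prod ν) ≤ T₁)
    (h₂ : ∫ x, q x ^ 2 ∂μ ≤ T₂) (h₃ : ∫ x, (q x - n) ^ 2 ∂μ ≤ T₃) :
    Integrable (fun p => (Q p - (m ^ 2 * n + m * n ^ 2)) ^ 2) (μ.prod ν) ∧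
    ∫ p, (Q p - (m ^ 2 * n + m * n ^ 2)) ^ 2 ∂(μ.prod ν) ≤
      3 * T₁ + (3 * (m ^ 2 + m * n) ^ 2 * T₃ + 3 * (m ^ 2 * k) * T₂) := by
  have iqn : Integrable (fun x => (q x - n) ^ 2) μ := (hq.sub (memLp_const n)).integrable_sq
  have i1 := hi.const_mul 3
  have i2 : Integrable (fun p : α × β => 3 * (m ^ 2 + m * n) ^ 2 * (q p.1 - n) ^ 2)
    (μ.prod ν) := (iqn.const_mul (3 * (m ^ 2 + m * n) ^ 2)).comp_fst ν
  have i3 : Integrable (fun p : α × β => 3 * (m ^ 2 * (κ - 2) ^ 2) * q p.1 ^ 2)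
    (μ.prod ν) := (hq.integrable_sq.const_mul (3 * (m ^ 2 * (κ - 2) ^ 2))).comp_fst ν
  have i23 : Integrable (fun p : α × β => 3 * (m ^ 2 + m * n) ^ 2 * (q p.1 - n) ^ 2 +
    3 * (m ^ 2 * (κ - 2) ^ 2) * q p.1 ^ 2) (μ.prod ν) := i2.add i3
  have hpt := fun p : α × β => sq_sub_le_of_kurtosis_split (Q p) (q p.1) m n κ
  refine ⟨(i1.add i23).mono' ((hQ.sub measurable_const).pow_const 2).aestronglyMeasurable
    (.of_forall fun p => ?_), ?_⟩
  · rw [Real.norm_of_nonneg (sq_nonneg _)]; exact hpt p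
  refine (integral_mono_of_nonneg (.of_forall fun p => sq_nonneg _) (i1.add i23)
    (.of_forall hpt)).trans ?_
  have e2 : ∫ p : α × β, 3 * (m ^ 2 + m * n) ^ 2 * (q p.1 - n) ^ 2 ∂(μ.prod ν) =
      3 * (m ^ 2 + m * n) ^ 2 * ∫ x, (q x - n) ^ 2 ∂μ := by
    rw [integral_const_mul, integral_fun_fst (fun x => (q x - n) ^ 2)]; simp
  have e3 : ∫ p : α × β, 3 * (m ^ 2 * (κ - 2) ^ 2) * q p.1 ^ 2 ∂(μ.prod ν) =
      3 * (m ^ 2 * (κ - 2) ^ 2) * ∫ x, q x ^ 2 ∂μ := by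
    rw [integral_const_mul, integral_fun_fst (fun x => q x ^ 2)]; simp
  rw [integral_add' i1 i23, integral_add i2 i3, integral_const_mul, e2, e3]
  have hk0 : 0 ≤ k := (sq_nonneg _).trans hk
  have hq0 : 0 ≤ ∫ x, q x ^ 2 ∂μ := integral_nonneg fun x => sq_nonneg _
  gcongr

/-- The squared length of `Sᵀ S z` concentrates around `m² n + m n²` when `z` is random as well. -/
lemma integral_sum_gramMulVec_sq_sub_sq_prod_le (hz : IsStandardVector z μ C)
    (hS : IsStandardMatrix S ν C κ) (hzm : ∀ i, Measurable (z i)) (hSm : ∀ k i, Measurable (S k i))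
    (hC : 1 ≤ C) (hm : m = Fintype.card γ) (hn : n = Fintype.card ι) (hm1 : 1 ≤ m) (hn1 : 1 ≤ n)
    (hκ0 : 0 ≤ κ) (hκ : κ ≤ C) :
    Integrable (fun p : α × β => (∑ i, gramMulVec (fun k i => S k i p.2) (fun j => z j p.1) i ^ 2 -
      (m ^ 2 * n + m * n ^ 2)) ^ 2) (μ.prod ν) ∧
    ∫ p : α × β, (∑ i, gramMulVec (fun k i => S k i p.2) (fun j => z j p.1) i ^ 2 -
      (m ^ 2 * n + m * n ^ 2)) ^ 2 ∂(μ.prod ν) ≤ 3771 * C ^ 3 * (m * n * (m + n) ^ 3) := by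
  have hC0 : 0 ≤ C := by linarith
  have hm0 : 0 ≤ m := by linarith
  have hQm : Measurable fun p : α × β =>
      ∑ i, gramMulVec (fun k i => S k i p.2) (fun j => z j p.1) i ^ 2 :=
    Finset.measurable_sum _ fun i _ => (measurable_gramMulVec hzm hSm i).pow_const 2
  have hqm : Measurable fun p : α × β => ∑ j, z j p.1 ^ 2 := by fun_prop
  have hVL : ∀ x, MemLp (fun y => ∑ i, gramMulVec (fun k i => S k i y) (fun j => z j x) i ^ 2) 2 ν :=
    fun x => memLp_finsetSum Finset.univ fun i _ =>
      memLp_sq_of_memLp_four (hS.memLp_gramMulVec (fun j => z j x) i)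
  have h2 := hz.integral_sum_sq_sq_le
  have h3 := hz.integral_sum_sq_sub_card_sq_le
  rw [← hn] at h2 h3
  set F : α × β → ℝ := fun p =>
    (∑ i, gramMulVec (fun k i => S k i p.2) (fun j => z j p.1) i ^ 2 -
      (m ^ 2 + m * (n + κ - 2)) * ∑ j, z j p.1 ^ 2) ^ 2 with hF
  have hFm : Measurable F := (hQm.sub (hqm.const_mul _)).pow_const 2
  have hFi : ∀ x, Integrable (fun y => F (x, y)) ν := fun x =>
    ((hVL x).sub (memLp_const ((m ^ 2 + m * (n + κ - 2)) * ∑ j, z j x ^ 2))).integrable_sq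
  have hFle : ∀ x, ∫ y, F (x, y) ∂ν ≤
      1252 * C ^ 2 * (m ^ 3 + m ^ 2 * n + m * n ^ 2) * (∑ j, z j x ^ 2) ^ 2 := fun x =>
    hS.integral_sum_gramMulVec_sq_sub_sq_le hC (fun j => z j x) hm hn hκ hn1
  obtain ⟨hi, h1⟩ := integrable_prod_of_integral_le hFm (fun p => sq_nonneg _) hFi
    (hz.memLp_sum_sq.integrable_sq.const_mul _) hFle
  rw [integral_const_mul] at h1
  have h1' := h1.trans (mul_le_mul_of_nonneg_left h2 (by positivity))
  have hκ2 : (κ - 2) ^ 2 ≤ 4 * C ^ 2 := by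
    have : |κ - 2| ≤ 2 * C := abs_le.2 ⟨by linarith, by linarith⟩
    calc (κ - 2) ^ 2 = |κ - 2| ^ 2 := (sq_abs _).symm
      _ ≤ (2 * C) ^ 2 := pow_le_pow_left₀ (abs_nonneg _) this 2
      _ = _ := by ring
  obtain ⟨hint, hle⟩ := integral_sq_sub_le_of_kurtosis_split hQm hz.memLp_sum_sq hκ2 hi h1' h2 h3
  exact ⟨hint, hle.trans (gram_variance_terms_le hC hm1 hn1)⟩

end Gram

/-- Fourth moments of order `n⁻²` of the weights, and concentration of their squared length, bound
the error term of the Berry–Esseen theorem with random weights. -/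
lemma integral_weight_error_le {β ι : Type*} [MeasurableSpace β] {ν : Measure β}
    [IsProbabilityMeasure ν] [Fintype ι] {V : β → ι → ℝ} (hV : Measurable V) {m n A B : ℝ}
    (hm : 0 < m) (hn : n = Fintype.card ι) (hn0 : 0 < n)
    (hA0 : 0 ≤ A) (hB0 : 0 ≤ B) (hV4 : ∀ i, Integrable (fun w => V w i ^ 4) ν)
    (hA : ∀ i, n ^ 2 * ∫ w, V w i ^ 4 ∂ν ≤ A)
    (hV2 : Integrable (fun w => (∑ i, V w i ^ 2 - 1) ^ 2) ν)
    (hB : ∫ w, (∑ i, V w i ^ 2 - 1) ^ 2 ∂ν ≤ B * (1 / n + 1 / m)) :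
    Integrable (fun w => (∑ i, |V w i| ^ 3) + |∑ i, V w i ^ 2 - 1|) ν ∧
    ∫ w, ((∑ i, |V w i| ^ 3) + |∑ i, V w i ^ 2 - 1|) ∂ν ≤
      (1 + A + √B) * (1 / √n + 1 / √m) := by
  have hs : √n ^ 2 = n := Real.sq_sqrt hn0.le
  have hsn : 0 < √n := Real.sqrt_pos.2 hn0
  -- the elementary bound `|u|³ ≤ 1 + u⁴` at `u = √n V`
  have hpt : ∀ w i, |V w i| ^ 3 ≤ (1 + n ^ 2 * V w i ^ 4) / (n * √n) := by
    intro w i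
    rw [le_div_iff₀ (by positivity)]
    set u := √n * |V w i| with hu
    have hu0 : 0 ≤ u := by positivity
    have e1 : |V w i| ^ 3 * (n * √n) = u ^ 3 := by
      rw [hu, mul_pow, show √n ^ 3 = √n ^ 2 * √n by ring, hs]; ring
    have e2 : n ^ 2 * V w i ^ 4 = u ^ 4 := by
      rw [hu, mul_pow, show √n ^ 4 = (√n ^ 2) ^ 2 by ring, hs, show |V w i| ^ 4 = (|V w i| ^ 2) ^ 2 by ring,
        sq_abs]; ring
    rw [e1, e2]
    rcases le_total u 1 with h | h
    · have : u ^ 3 ≤ 1 := pow_le_one₀ hu0 h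
      have : 0 ≤ u ^ 4 := by positivity
      linarith
    · have : u ^ 3 ≤ u ^ 4 := pow_le_pow_right₀ h (by norm_num)
      linarith
  have hi4 : ∀ i, Integrable (fun w => (1 + n ^ 2 * V w i ^ 4) / (n * √n)) ν := fun i =>
    ((integrable_const 1).add ((hV4 i).const_mul _)).div_const _
  have hi3 : ∀ i, Integrable (fun w => |V w i| ^ 3) ν := fun i => by
    refine (hi4 i).mono' (Measurable.aestronglyMeasurable (by fun_prop)) (.of_forall fun w => ?_)
    rw [Real.norm_of_nonneg (by positivity)]
    exact hpt w i
  have hVm : Measurable fun w => ∑ i, V w i ^ 2 - 1 := by fun_prop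
  have hL2 : MemLp (fun w => |∑ i, V w i ^ 2 - 1|) 2 ν :=
    ((memLp_two_iff_integrable_sq hVm.aestronglyMeasurable).2 hV2).abs
  have hi2 : Integrable (fun w => |∑ i, V w i ^ 2 - 1|) ν := hL2.integrable (by norm_num)
  have hisum : Integrable (fun w => ∑ i, |V w i| ^ 3) ν := integrable_finsetSum _ fun i _ => hi3 i
  refine ⟨hisum.add hi2, ?_⟩
  rw [integral_add hisum hi2, integral_finsetSum _ fun i _ => hi3 i]
  have h3 : ∑ i, ∫ w, |V w i| ^ 3 ∂ν ≤ (1 + A) * (1 / √n) := by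
    have : ∀ i, ∫ w, |V w i| ^ 3 ∂ν ≤ (1 + A) / (n * √n) := by
      intro i
      refine (integral_mono (hi3 i) (hi4 i) fun w => hpt w i).trans ?_
      rw [integral_div, integral_add (integrable_const 1) ((hV4 i).const_mul _), integral_const_mul]
      simp only [integral_const, probReal_univ, one_smul]
      have := hA i
      gcongr
    refine (Finset.sum_le_sum fun i _ => this i).trans_eq ?_
    rw [Finset.sum_const, Finset.card_univ, nsmul_eq_mul, ← hn]
    field_simp
  have h2 : ∫ w, |∑ i, V w i ^ 2 - 1| ∂ν ≤ √B * (1 / √n + 1 / √m) := by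
    refine le_of_sq_le_sq ?_ (by positivity)
    refine (sq_integral_le_integral_sq hL2).trans ?_
    simp_rw [sq_abs]
    refine hB.trans ?_
    rw [mul_pow, Real.sq_sqrt hB0]
    refine mul_le_mul_of_nonneg_left ?_ hB0
    have e1 : (1 / √n) ^ 2 = 1 / n := by rw [div_pow, hs, one_pow]
    have e2 : (1 / √m) ^ 2 = 1 / m := by rw [div_pow, Real.sq_sqrt hm.le, one_pow]
    have : 0 ≤ 1 / √n * (1 / √m) := by positivity
    nlinarith
  have h4 : (1 + A) * (1 / √n) ≤ (1 + A) * (1 / √n + 1 / √m) :=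
    mul_le_mul_of_nonneg_left (le_add_of_nonneg_right (by positivity)) (by linarith)
  linarith

/-! ### Product laws and the invariance principle -/

section ProductLaw
variable {ι γ : Type*} [Fintype ι] [Fintype γ] {C κ : ℝ}

lemma MeasureTheory.MeasurePreserving.integral_comp_real {α : Type*} [MeasurableSpace α]
    {μ : Measure α} {ν : Measure ℝ} {f : α → ℝ} (hf : MeasurePreserving f μ ν) {g : ℝ → ℝ}
    (hg : Continuous g) : ∫ x, g (f x) ∂μ = ∫ y, g y ∂ν := by
  rw [← hf.map_eq, integral_map hf.measurable.aemeasurable hg.aestronglyMeasurable]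

lemma isStandardVector_pi (ν : ι → Measure ℝ) [∀ i, IsProbabilityMeasure (ν i)]
    (h4 : ∀ i, MemLp id 4 (ν i)) (hx2 : ∀ i, ∫ x, x ^ 2 ∂(ν i) = 1)
    (hx4 : ∀ i, ∫ x, x ^ 4 ∂(ν i) ≤ C) :
    IsStandardVector (fun i (z : ι → ℝ) => z i) (Measure.pi ν) C := by
  have hp := fun i => measurePreserving_eval ν i
  refine ⟨iIndepFun_pi (X := fun _ => id) fun _ => aemeasurable_id,
    fun i => (h4 i).comp_measurePreserving (hp i), fun i => ?_, fun i => ?_⟩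
  · exact ((hp i).integral_comp_real (g := fun x => x ^ 2) (by fun_prop)).trans (hx2 i)
  · exact ((hp i).integral_comp_real (g := fun x => x ^ 4) (by fun_prop)).trans_le (hx4 i)

lemma isStandardMatrix_pi (ν : γ → ι → Measure ℝ) [∀ k i, IsProbabilityMeasure (ν k i)]
    (h8 : ∀ k i, MemLp id 8 (ν k i)) (hx1 : ∀ k i, ∫ x, x ∂(ν k i) = 0)
    (hx2 : ∀ k i, ∫ x, x ^ 2 ∂(ν k i) = 1) (hx4 : ∀ k i, ∫ x, x ^ 4 ∂(ν k i) = κ)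
    (hx8 : ∀ k i, ∫ x, x ^ 8 ∂(ν k i) ≤ C) :
    IsStandardMatrix (fun k i (S : γ → ι → ℝ) => S k i)
      (Measure.pi fun k => Measure.pi fun i => ν k i) C κ := by
  have hrow := fun k => measurePreserving_eval (fun k => Measure.pi fun i => ν k i) k
  have hp : ∀ k i, MeasurePreserving (fun S : γ → ι → ℝ => S k i)
      (Measure.pi fun k => Measure.pi fun i => ν k i) (ν k i) := fun k i =>
    (measurePreserving_eval (fun i => ν k i) i).comp (hrow k)
  refine ⟨iIndepFun_pi (X := fun _ => id) fun _ => aemeasurable_id, fun k => ⟨?_,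
    fun i => (h8 k i).comp_measurePreserving (hp k i), fun i => ?_, fun i => ?_, fun i => ?_,
    fun i => ?_⟩⟩
  · rw [iIndepFun_iff_map_fun_eq_pi_map fun i => (hp k i).measurable.aemeasurable]
    simp_rw [(hp k _).map_eq]
    exact (hrow k).map_eq
  · exact ((hp k i).integral_comp_real (g := fun x => x) (by fun_prop)).trans (hx1 k i)
  · exact ((hp k i).integral_comp_real (g := fun x => x ^ 2) (by fun_prop)).trans (hx2 k i)
  · exact ((hp k i).integral_comp_real (g := fun x => x ^ 4) (by fun_prop)).trans (hx4 k i)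
  · exact ((hp k i).integral_comp_real (g := fun x => x ^ 8) (by fun_prop)).trans_le (hx8 k i)

end ProductLaw

section Weights
variable {α β : Type*} [MeasurableSpace α] [MeasurableSpace β] {μ : Measure α} {ν : Measure β}
  [IsProbabilityMeasure μ] [IsProbabilityMeasure ν] {ι γ : Type*} [Fintype ι] [Fintype γ]
  {z : ι → α → ℝ} {S : γ → ι → β → ℝ} {C κ m n : ℝ}

/-- The error term of the Berry–Esseen bound for the weights `Sᵀ S z / √(m² n + m n²)`. -/
lemma integral_gramMulVec_weight_error_le (hz : IsStandardVector z μ C)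
    (hS : IsStandardMatrix S ν C κ) (hzm : ∀ i, Measurable (z i)) (hSm : ∀ k i, Measurable (S k i))
    (hC : 1 ≤ C) (hm : m = Fintype.card γ) (hn : n = Fintype.card ι) (hm1 : 1 ≤ m) (hn1 : 1 ≤ n)
    (hκ0 : 0 ≤ κ) (hκ : κ ≤ C) {V : α × β → ι → ℝ}
    (hV : V = fun p i => 1 / √(m ^ 2 * n + m * n ^ 2) *
      gramMulVec (fun k i => S k i p.2) (fun j => z j p.1) i) :
    Integrable (fun w => (∑ i, |V w i| ^ 3) + |∑ i, V w i ^ 2 - 1|) (μ.prod ν) ∧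
    ∫ w, ((∑ i, |V w i| ^ 3) + |∑ i, V w i ^ 2 - 1|) ∂(μ.prod ν) ≤
      (1 + 6944 * C ^ 3 + √(3771 * C ^ 3)) * (1 / √n + 1 / √m) := by
  have hC0 : 0 ≤ C := by linarith
  have hm0 : 0 < m := by linarith
  have hn0 : 0 < n := by linarith
  set v := m ^ 2 * n + m * n ^ 2 with hv
  have hv0 : 0 < v := by positivity
  have hs2 : (1 / √v) ^ 2 = 1 / v := by rw [div_pow, Real.sq_sqrt hv0.le, one_pow]
  have hs4 : (1 / √v) ^ 4 = 1 / v ^ 2 := by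
    rw [show (1 / √v) ^ 4 = ((1 / √v) ^ 2) ^ 2 by ring, hs2, div_pow, one_pow]
  have e4 : ∀ i p, V p i ^ 4 =
      1 / v ^ 2 * gramMulVec (fun k i => S k i p.2) (fun j => z j p.1) i ^ 4 := fun i p => by
    rw [hV, mul_pow, hs4]
  have e2 : ∀ p, (∑ i, V p i ^ 2 - 1) ^ 2 = 1 / v ^ 2 *
      (∑ i, gramMulVec (fun k i => S k i p.2) (fun j => z j p.1) i ^ 2 - v) ^ 2 := fun p => by
    simp_rw [hV, mul_pow, hs2]
    rw [← Finset.mul_sum]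
    field_simp
  have h4 := fun i => integral_gramMulVec_pow_four_prod_le hz hS hzm hSm hC hm hn i
  have h2 := integral_sum_gramMulVec_sq_sub_sq_prod_le hz hS hzm hSm hC hm hn hm1 hn1 hκ0 hκ
  refine integral_weight_error_le ?_ hm0 hn hn0 (by positivity) (by positivity) (fun i => ?_)
    (fun i => ?_) ?_ ?_
  · rw [hV]
    exact measurable_pi_lambda _ fun i => (measurable_gramMulVec hzm hSm i).const_mul _
  · simp_rw [e4]
    exact (h4 i).1.const_mul _
  · simp_rw [e4]
    rw [integral_const_mul]
    calc n ^ 2 * (1 / v ^ 2 * _) ≤ n ^ 2 * (1 / v ^ 2 * (6944 * C ^ 3 * (m ^ 2 * (m ^ 2 + n ^ 2)))) := by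
          have := (h4 i).2
          gcongr
      _ = 6944 * C ^ 3 * ((m ^ 2 + n ^ 2) / (m + n) ^ 2) := by rw [hv]; field_simp
      _ ≤ 6944 * C ^ 3 * 1 := by
          gcongr
          rw [div_le_one (by positivity)]
          nlinarith [mul_pos hm0 hn0]
      _ = _ := mul_one _
  · simp_rw [e2]
    exact h2.1.const_mul _
  · simp_rw [e2]
    rw [integral_const_mul]
    calc 1 / v ^ 2 * _ ≤ 1 / v ^ 2 * (3771 * C ^ 3 * (m * n * (m + n) ^ 3)) :=
          mul_le_mul_of_nonneg_left h2.2 (by positivity)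
      _ = 3771 * C ^ 3 * (1 / n + 1 / m) := by rw [hv]; field_simp

/-- The error term of the Berry–Esseen bound for the weights `z / √n`. -/
lemma integral_vector_weight_error_le (hz : IsStandardVector z μ C) (hzm : ∀ i, Measurable (z i))
    (hC : 1 ≤ C) (hm1 : 1 ≤ m) (hn : n = Fintype.card ι) (hn1 : 1 ≤ n) {V : α × β → ι → ℝ}
    (hV : V = fun p i => 1 / √n * z i p.1) :
    Integrable (fun w => (∑ i, |V w i| ^ 3) + |∑ i, V w i ^ 2 - 1|) (μ.prod ν) ∧
    ∫ w, ((∑ i, |V w i| ^ 3) + |∑ i, V w i ^ 2 - 1|) ∂(μ.prod ν) ≤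
      (1 + C + √C) * (1 / √n + 1 / √m) := by
  have hC0 : 0 ≤ C := by linarith
  have hm0 : 0 < m := by linarith
  have hn0 : 0 < n := by linarith
  have hs2 : (1 / √n) ^ 2 = 1 / n := by rw [div_pow, Real.sq_sqrt hn0.le, one_pow]
  have hs4 : (1 / √n) ^ 4 = 1 / n ^ 2 := by
    rw [show (1 / √n) ^ 4 = ((1 / √n) ^ 2) ^ 2 by ring, hs2, div_pow, one_pow]
  have e4 : ∀ i p, V p i ^ 4 = 1 / n ^ 2 * z i p.1 ^ 4 := fun i p => by rw [hV, mul_pow, hs4]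
  have e2 : ∀ p, (∑ i, V p i ^ 2 - 1) ^ 2 = 1 / n ^ 2 * (∑ i, z i p.1 ^ 2 - n) ^ 2 := fun p => by
    simp_rw [hV, mul_pow, hs2]
    rw [← Finset.mul_sum]
    field_simp
  have h3 := hz.integral_sum_sq_sub_card_sq_le
  rw [← hn] at h3
  refine integral_weight_error_le ?_ hm0 hn hn0 hC0 hC0 (fun i => ?_) (fun i => ?_) ?_ ?_
  · rw [hV]
    exact measurable_pi_lambda _ fun i => ((hzm i).comp measurable_fst).const_mul _
  · simp_rw [e4]
    exact ((hz.integrable_pow_four i).comp_fst ν).const_mul _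
  · simp_rw [e4]
    rw [integral_const_mul, integral_fun_fst (fun x => z i x ^ 4)]
    simp only [probReal_univ, one_smul]
    rw [← mul_assoc, mul_one_div_cancel (by positivity), one_mul]
    exact hz.fourth i
  · simp_rw [e2]
    exact (((hz.memLp_sum_sq.sub (memLp_const n)).integrable_sq).comp_fst ν).const_mul _
  · simp_rw [e2]
    rw [integral_const_mul, integral_fun_fst (fun x => (∑ i, z i x ^ 2 - n) ^ 2)]
    simp only [probReal_univ, one_smul]
    calc 1 / n ^ 2 * _ ≤ 1 / n ^ 2 * (C * n) := mul_le_mul_of_nonneg_left h3 (by positivity)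
      _ = C * (1 / n) := by field_simp
      _ ≤ C * (1 / n + 1 / m) :=
        mul_le_mul_of_nonneg_left (le_add_of_nonneg_right (by positivity)) hC0

end Weights

section Law
variable {Ω : Type*} [MeasurableSpace Ω] {P : Measure Ω} {f : Ω → ℝ} {p : ℕ}

lemma memLp_id_map {p : ENNReal} (hf : MemLp f p P) : MemLp id p (P.map f) :=
  (memLp_map_measure_iff aestronglyMeasurable_id hf.1.aemeasurable).2 hf

lemma integral_map_of_continuous (hf : AEMeasurable f P) {g : ℝ → ℝ} (hg : Continuous g) :
    ∫ x, g x ∂(P.map f) = ∫ ω, g (f ω) ∂P :=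
  integral_map hf hg.aestronglyMeasurable

end Law

lemma dotProduct_gram_mulVec {m n : ℕ} (x z : Fin n → ℝ) (S : Matrix (Fin m) (Fin n) ℝ) (c : ℝ) :
    c * (x ⬝ᵥ ((Sᵀ * S) *ᵥ z)) = ∑ i, x i * (c * gramMulVec (fun k i => S k i) z i) := by
  rw [← Matrix.mulVec_mulVec, dotProduct, Finset.mul_sum]
  refine Finset.sum_congr rfl fun i _ => ?_
  rw [Matrix.mulVec, dotProduct]
  simp only [Matrix.transpose_apply, Matrix.mulVec, dotProduct, gramMulVec]
  ring

/-- Both statistics are close to a standard Gaussian, at a single point. -/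
theorem exists_kolmogorov_bounds {C : ℝ} (hC : 1 ≤ C) :
    ∃ K : ℝ, 0 < K ∧
      ∀ (m n : ℕ), 1 ≤ m → 1 ≤ n →
      ∀ {Ω : Type*} [MeasurableSpace Ω] (P : Measure Ω) [IsProbabilityMeasure P]
        (X Z : Ω → Fin n → ℝ) (S : Ω → Matrix (Fin m) (Fin n) ℝ),
      iIndepFun
        (Sum.elim (fun (i : Fin n) ω => X ω i)
          (Sum.elim (fun (i : Fin n) ω => Z ω i)
            (fun (p : Fin m × Fin n) ω => S ω p.1 p.2))) P →
      (∀ i j k l, IdentDistrib (fun ω => S ω i j) (fun ω => S ω k l) P P) →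
      (∀ i, MemLp (fun ω => X ω i) 3 P ∧ ∫ ω, X ω i ∂P = 0 ∧ ∫ ω, X ω i ^ 2 ∂P = 1 ∧
        ∫ ω, |X ω i| ^ 3 ∂P ≤ C) →
      (∀ i, MemLp (fun ω => Z ω i) 4 P ∧ ∫ ω, Z ω i ^ 2 ∂P = 1 ∧ ∫ ω, Z ω i ^ 4 ∂P ≤ C) →
      (∀ i j, MemLp (fun ω => S ω i j) 8 P ∧ ∫ ω, S ω i j ∂P = 0 ∧ ∫ ω, S ω i j ^ 2 ∂P = 1 ∧
        ∫ ω, S ω i j ^ 8 ∂P ≤ C) →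
      ∀ t : ℝ,
      |P.real {ω | 1 / √((m : ℝ) ^ 2 * n + m * (n : ℝ) ^ 2) *
            (X ω ⬝ᵥ (((S ω)ᵀ * S ω) *ᵥ Z ω)) < t} - (gaussianReal 0 1).real (Set.Iio t)|
        ≤ K * (1 / √(n : ℝ) + 1 / √(m : ℝ)) ∧
      |P.real {ω | 1 / √(n : ℝ) * (X ω ⬝ᵥ Z ω) < t} - (gaussianReal 0 1).real (Set.Iio t)|
        ≤ K * (1 / √(n : ℝ) + 1 / √(m : ℝ)) := by
  obtain ⟨K, hK, hBE⟩ := exists_berryEsseen_random_weights hC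
  have hC0 : 0 ≤ C := by linarith
  refine ⟨K * ((1 + 6944 * C ^ 3 + √(3771 * C ^ 3)) + (1 + C + √C)), by positivity,
    fun m n hm hn Ω _ P _ X Z S hind hSid hX hZ hS t => ?_⟩
  have hXm : ∀ i, AEMeasurable (fun ω => X ω i) P := fun i => (hX i).1.1.aemeasurable
  have hZm : ∀ i, AEMeasurable (fun ω => Z ω i) P := fun i => (hZ i).1.1.aemeasurable
  have hSm : ∀ k i, AEMeasurable (fun ω => S ω k i) P := fun k i => (hS k i).1.1.aemeasurable
  have : ∀ i, IsProbabilityMeasure (P.map fun ω => X ω i) := fun i =>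
    Measure.isProbabilityMeasure_map (hXm i)
  have : ∀ i, IsProbabilityMeasure (P.map fun ω => Z ω i) := fun i =>
    Measure.isProbabilityMeasure_map (hZm i)
  have : ∀ k i, IsProbabilityMeasure (P.map fun ω => S ω k i) := fun k i =>
    Measure.isProbabilityMeasure_map (hSm k i)
  have hm' : (1 : ℝ) ≤ m := by exact_mod_cast hm
  have hn' : (1 : ℝ) ≤ n := by exact_mod_cast hn
  set k₀ : Fin m := ⟨0, hm⟩
  set i₀ : Fin n := ⟨0, hn⟩
  set κ := ∫ ω, S ω k₀ i₀ ^ 4 ∂P with hκ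
  have hlaw := map_prodMk_eq_prod_pi_of_iIndepFun (S := fun k i ω => S ω k i) hind hXm hZm hSm
  have hzv := isStandardVector_pi (C := C) (fun i => P.map fun ω => Z ω i)
    (fun i => memLp_id_map (hZ i).1)
    (fun i => (integral_map_of_continuous (hZm i) (by fun_prop)).trans (hZ i).2.1)
    (fun i => (integral_map_of_continuous (hZm i) (by fun_prop)).trans_le (hZ i).2.2)
  have hSv := isStandardMatrix_pi (C := C) (κ := κ) (fun k i => P.map fun ω => S ω k i)
    (fun k i => memLp_id_map (hS k i).1)
    (fun k i => (integral_map_of_continuous (g := fun x => x) (hSm k i) (by fun_prop)).trans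
      (hS k i).2.1)
    (fun k i => (integral_map_of_continuous (hSm k i) (by fun_prop)).trans (hS k i).2.2.1)
    (fun k i => (integral_map_of_continuous (hSm k i) (by fun_prop)).trans
      ((hSid k i k₀ i₀).comp (u := fun x => x ^ 4) (by fun_prop)).integral_eq)
    (fun k i => (integral_map_of_continuous (hSm k i) (by fun_prop)).trans_le (hS k i).2.2.2)
  have hκ0 : 0 ≤ κ := (hSv.row k₀).kurtosis_nonneg i₀
  have hκC : κ ≤ C := (hSv.row k₀).kurtosis_le hC i₀
  have hmeas : AEMeasurable (fun ω => ((fun i => X ω i), (fun i => Z ω i), fun k i => S ω k i)) P :=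
    (aemeasurable_pi_lambda _ hXm).prodMk ((aemeasurable_pi_lambda _ hZm).prodMk
      (aemeasurable_pi_lambda _ fun k => aemeasurable_pi_lambda _ (hSm k)))
  set ρ := (Measure.pi fun i => P.map fun ω => Z ω i).prod
    (Measure.pi fun k => Measure.pi fun i => P.map fun ω => S ω k i) with hρ
  -- any statistic linear in `X` is handled by conditioning on `Z` and `S`
  have key : ∀ (V : (Fin n → ℝ) × (Fin m → Fin n → ℝ) → Fin n → ℝ) (A : ℝ), Measurable V →
      0 ≤ A → (Integrable (fun w => (∑ i, |V w i| ^ 3) + |∑ i, V w i ^ 2 - 1|) ρ ∧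
        ∫ w, ((∑ i, |V w i| ^ 3) + |∑ i, V w i ^ 2 - 1|) ∂ρ ≤ A * (1 / √(n : ℝ) + 1 / √(m : ℝ))) →
      |P.real {ω | ∑ i, X ω i * V (Z ω, fun k i => S ω k i) i < t} -
        (gaussianReal 0 1).real (Set.Iio t)| ≤ K * (A * (1 / √(n : ℝ) + 1 / √(m : ℝ))) := by
    intro V A hV hA h
    have hset : MeasurableSet {p : (Fin n → ℝ) × (Fin n → ℝ) × (Fin m → Fin n → ℝ) |
        ∑ i, p.1 i * V p.2 i < t} := measurableSet_lt (by fun_prop) measurable_const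
    have e : P.real {ω | ∑ i, X ω i * V (Z ω, fun k i => S ω k i) i < t} =
        ((Measure.pi fun i => P.map fun ω => X ω i).prod ρ).real
          {p | ∑ i, p.1 i * V p.2 i < t} := by
      rw [hρ, ← hlaw, map_measureReal_apply_of_aemeasurable hmeas hset]
      rfl
    rw [e]
    refine (hBE (fun i => P.map fun ω => X ω i) (fun i => memLp_id_map (hX i).1)
      (fun i => (integral_map_of_continuous (g := fun x => x) (hXm i) (by fun_prop)).trans
        (hX i).2.1)
      (fun i => (integral_map_of_continuous (hXm i) (by fun_prop)).trans (hX i).2.2.1)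
      (fun i => (integral_map_of_continuous (g := fun x => |x| ^ 3) (hXm i)
        (by fun_prop)).trans_le (hX i).2.2.2) ρ V hV h.1 t).trans ?_
    exact mul_le_mul_of_nonneg_left h.2 hK.le
  have hε : 0 ≤ 1 / √(n : ℝ) + 1 / √(m : ℝ) := by positivity
  have hA : 0 ≤ 1 + 6944 * C ^ 3 + √(3771 * C ^ 3) := by positivity
  have hB : 0 ≤ 1 + C + √C := by positivity
  constructor
  · have hgram := integral_gramMulVec_weight_error_le hzv hSv (fun i => measurable_pi_apply i)
      (fun k i => by fun_prop) hC (m := m) (n := n) (by simp) (by simp) hm' hn' hκ0 hκC rfl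
    have h := key _ _ (measurable_pi_lambda _ fun i => (measurable_gramMulVec
      (z := fun i (z : Fin n → ℝ) => z i) (S := fun k i (S : Fin m → Fin n → ℝ) => S k i)
      (fun i => measurable_pi_apply i) (fun k i => by fun_prop) i).const_mul _) hA hgram
    simp_rw [dotProduct_gram_mulVec]
    refine h.trans ?_
    rw [← mul_assoc]
    exact mul_le_mul_of_nonneg_right (mul_le_mul_of_nonneg_left (by linarith) hK.le) hε
  · have hvec := integral_vector_weight_error_le
      (ν := Measure.pi fun k => Measure.pi fun i => P.map fun ω => S ω k i) hzv
      (fun i => measurable_pi_apply i) hC (m := m) (n := n) hm' (by simp) hn' rfl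
    have h := key _ _ (measurable_pi_lambda _ fun i =>
      ((measurable_pi_apply i).comp measurable_fst).const_mul _) hB hvec
    have e : ∀ ω, 1 / √(n : ℝ) * (X ω ⬝ᵥ Z ω) = ∑ i, X ω i * (1 / √(n : ℝ) * Z ω i) := fun ω => by
      rw [dotProduct, Finset.mul_sum]
      exact Finset.sum_congr rfl fun i _ => by ring
    simp_rw [e]
    refine h.trans ?_
    rw [← mul_assoc]
    exact mul_le_mul_of_nonneg_right (mul_le_mul_of_nonneg_left (by linarith) hK.le) hε

theorem mainTheorem4 (C : ℝ) :
    ∃ K : ℝ, 0 < K ∧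
      ∀ (m n : ℕ), 1 ≤ m → 1 ≤ n →
      ∀ {Ω : Type*} [MeasurableSpace Ω] (P : Measure Ω) [IsProbabilityMeasure P]
        (X Z : Ω → Fin n → ℝ) (S : Ω → Matrix (Fin m) (Fin n) ℝ),
      -- all entries of `X`, `Z` and `S` are mutually independent
      iIndepFun
        (Sum.elim (fun (i : Fin n) ω => X ω i)
          (Sum.elim (fun (i : Fin n) ω => Z ω i)
            (fun (p : Fin m × Fin n) ω => S ω p.1 p.2))) P →
      -- within each of `X`, `Z` and `S` the entries are identically distributed
      (∀ i j, IdentDistrib (fun ω => X ω i) (fun ω => X ω j) P P) →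
      (∀ i j, IdentDistrib (fun ω => Z ω i) (fun ω => Z ω j) P P) →
      (∀ i j k l, IdentDistrib (fun ω => S ω i j) (fun ω => S ω k l) P P) →
      -- moment assumptions on `X`
      (∀ i, MemLp (fun ω => X ω i) 3 P ∧ ∫ ω, X ω i ∂P = 0 ∧ ∫ ω, X ω i ^ 2 ∂P = 1 ∧
        ∫ ω, |X ω i| ^ 3 ∂P < C) →
      -- moment assumptions on `Z`
      (∀ i, MemLp (fun ω => Z ω i) 4 P ∧ ∫ ω, Z ω i ∂P = 0 ∧ ∫ ω, Z ω i ^ 2 ∂P = 1 ∧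
        ∫ ω, |Z ω i| ^ 3 ∂P < C ∧ ∫ ω, Z ω i ^ 4 ∂P < C) →
      -- moment assumptions on `S`
      (∀ i j, MemLp (fun ω => S ω i j) 8 P ∧ ∫ ω, S ω i j ∂P = 0 ∧ ∫ ω, S ω i j ^ 2 ∂P = 1 ∧
        ∫ ω, S ω i j ^ 8 ∂P < C) →
      (⨆ t : ℝ,
        |P.real {ω | 1 / √((m : ℝ) ^ 2 * n + m * (n : ℝ) ^ 2) *
              (X ω ⬝ᵥ (((S ω)ᵀ * S ω) *ᵥ Z ω)) < t}
          - (gaussianReal 0 1).real (Set.Iio t)|)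
        ≤ K * (1 / √(n : ℝ) + 1 / √(m : ℝ)) ∧
      (⨆ t : ℝ,
        |P.real {ω | 1 / √((m : ℝ) ^ 2 * n + m * (n : ℝ) ^ 2) *
              (X ω ⬝ᵥ (((S ω)ᵀ * S ω) *ᵥ Z ω)) < t}
          - P.real {ω | 1 / √(n : ℝ) * (X ω ⬝ᵥ Z ω) < t}|)
        ≤ K * (1 / √(n : ℝ) + 1 / √(m : ℝ)) := by
  obtain ⟨K, hK, hmain⟩ := exists_kolmogorov_bounds (le_max_right C 1)
  refine ⟨2 * K, by positivity,
    fun m n hm hn Ω _ P _ X Z S hind _ _ hSid hX hZ hS => ?_⟩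
  have h := hmain m n hm hn P X Z S hind hSid
    (fun i => ⟨(hX i).1, (hX i).2.1, (hX i).2.2.1, (hX i).2.2.2.le.trans (le_max_left C 1)⟩)
    (fun i => ⟨(hZ i).1, (hZ i).2.2.1, (hZ i).2.2.2.2.le.trans (le_max_left C 1)⟩)
    (fun i j => ⟨(hS i j).1, (hS i j).2.1, (hS i j).2.2.1,
      (hS i j).2.2.2.le.trans (le_max_left C 1)⟩)
  have hε : 0 ≤ K * (1 / √(n : ℝ) + 1 / √(m : ℝ)) := by positivity
  refine ⟨ciSup_le fun t => ?_, ciSup_le fun t => ?_⟩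
  · linarith [(h t).1]
  · refine (abs_sub_le _ ((gaussianReal 0 1).real (Set.Iio t)) _).trans ?_
    have h2 := (h t).2
    rw [abs_sub_comm] at h2
    linarith [(h t).1]
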